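/- A $(0,1)$-matrix is \emph{simple} if it has no repeated columns. For $(0,1)$-matrices $F,A$ write $F\prec A$ if some submatrix of $A$ is a row and column permutation of $F$. For a family $\mathcal F$ of $(0,1)$-matrices let $\mathrm{forb}(m,\mathcal F)$ be the maximum number of columns of a simple $m$-rowed $(0,1)$-matrix $A$ such that $F\not\prec A$ for all $F\in\mathcal F$ (a matrix with no columns is allowed, so the maximum may be $0$). Let $I_\ell$ be the $\ell\times\ell$ identity matrix, $I_\ell^c$ its $(0,1)$-complement, and $T_\ell$ the $\ell\times\ell$ matrix with a $1$ in position $(i,j)$ if and only if $i\le j$. Let $$Q_1=\begin{bmatrix}0&0\\0&0\end{bmatrix},\quad Q_2=\begin{bmatrix}1&1\\1&1\end{bmatrix},\quad Q_3=\begin{bmatrix}0&0&0&1&1&1\\0&1&1&0&0&1\end{bmatrix},\quad Q_4=\begin{bmatrix}0\\0\\0\end{bmatrix},\quad Q_5=\begin{bmatrix}1\\1\\1\end{bmatrix},$$ $$Q_6=\begin{bmatrix}1&0&0\\0&1&0\\0&0&1\end{bmatrix},\quad Q_7=\begin{bmatrix}0&1&1\\1&0&1\\1&1&0\end{bmatrix},\quad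 Q_8=\begin{bmatrix}1&0&1&0\\0&1&0&1\\0&0&1&1\end{bmatrix},\quad Q_9=\begin{bmatrix}1&0\\1&0\\0&1\\0&1\end{bmatrix}.$$ \textbf{Theorem.} Let $\mathcal F$ be a nonempty subset of $\{Q_1,\dots,Q_9\}$. All asymptotics are for $m\to\infty$. (1) $\mathrm{forb}(m,\mathcal F)$ is $\Theta(m^2)$ if and only if $\mathcal F\subseteq\{Q_1,Q_4,Q_6\}$, or $\mathcal F\subseteq\{Q_2,Q_5,Q_7\}$, or $\mathcal F\subseteq\{Q_6,Q_7,Q_8\}$, or $\mathcal F\subseteq\{Q_6,Q_9\}$, or $\mathcal F\subseteq\{Q_7,Q_9\}$, or $\mathcal F=\{Q_3\}$. (2) In all other cases $\mathrm{forb}(m,\mathcal F)$ is $O(m)$. More precisely, in those cases consider the condition $(*)$ there are $\ell$ and $F,F',F''\in\mathcal F$ with $F\prec I_\ell$, $F'\prec I_\ell^c$ and $F''\prec T_\ell$. If $(*)$ fails, then $\mathrm{forb}(m,\mathcal F)$ is $\Theta(m)$. If $(*)$ holds, then there is a constant $c$ (depending only on $\mathcal F$) with $\mathrm{forb}(m,\mathcal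 F)=c$ for all sufficiently large $m$; here $c=0$ if and only if $\{Q_4,Q_5\}\subseteq\mathcal F$. In particular $\mathrm{forb}(m,\mathcal F)$ is $\Theta(1)$ if $(*)$ holds and $\{Q_4,Q_5\}\not\subseteq\mathcal F$. -/

import Mathlib

open Filter Asymptotics

namespace ForbConf

/-- A finite (0,1)-matrix of arbitrary size. -/
structure Config where
  rows : ℕ
  cols : ℕ
  entry : Matrix (Fin rows) (Fin cols) (Fin 2)

/-- A matrix given by its entries, regarded as a configuration. -/
def conf {k l : ℕ} (M : Matrix (Fin k) (Fin l) (Fin 2)) : Config := ⟨k, l, M⟩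

/-- `F ≺ A`: some submatrix of `A` is a row and column permutation of `F`. -/
def Config.In (F A : Config) : Prop :=
  ∃ (f : Fin F.rows ↪ Fin A.rows) (g : Fin F.cols ↪ Fin A.cols),
    A.entry.submatrix f g = F.entry

/-- No repeated columns. -/
def IsSimple {m n : ℕ} (A : Matrix (Fin m) (Fin n) (Fin 2)) : Prop :=
  ∀ j j' : Fin n, (∀ i, A i j = A i j') → j = j'

/-- `A ∈ Avoid(m, ℱ)`, for an `m`-rowed matrix `A` with `n` columns. -/
def Avoids {m n : ℕ} (A : Matrix (Fin m) (Fin n) (Fin 2)) (ℱ : Set Config) : Prop :=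
  IsSimple A ∧ ∀ F ∈ ℱ, ¬ F.In (conf A)

/-- The numbers of columns of the matrices in `Avoid(m, ℱ)`. -/
def colCounts (m : ℕ) (ℱ : Set Config) : Set ℕ :=
  {n | ∃ A : Matrix (Fin m) (Fin n) (Fin 2), Avoids A ℱ}

/-- `forb(m, ℱ)`: the maximum number of columns of a matrix in `Avoid(m, ℱ)`. -/
noncomputable def forb (m : ℕ) (ℱ : Set Config) : ℕ := sSup (colCounts m ℱ)

/-- `forb` is a supremum of a bounded set, hence a maximum if the set is nonempty. -/
theorem bddAbove_colCounts (m : ℕ) (ℱ : Set Config) : BddAbove (colCounts m ℱ) := by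
  refine ⟨Fintype.card (Fin m → Fin 2), ?_⟩
  rintro n ⟨A, hA, -⟩
  have h : Function.Injective (fun (j : Fin n) (i : Fin m) => A i j) :=
    fun j j' hj => hA j j' (fun i => congrFun hj i)
  simpa using Fintype.card_le_of_injective _ h

/-- `I_l`, the identity matrix. -/
def matI (l : ℕ) : Matrix (Fin l) (Fin l) (Fin 2) := Matrix.of fun i j => if i = j then 1 else 0

/-- `I_l^c`, the (0,1)-complement of the identity matrix. -/
def matIc (l : ℕ) : Matrix (Fin l) (Fin l) (Fin 2) := Matrix.of fun i j => if i = j then 0 else 1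

/-- `T_l`, the triangular matrix. -/
def matT (l : ℕ) : Matrix (Fin l) (Fin l) (Fin 2) := Matrix.of fun i j => if i ≤ j then 1 else 0

def Q1 : Config := conf !![0, 0; 0, 0]

def Q2 : Config := conf !![1, 1; 1, 1]

def Q3 : Config := conf !![0, 0, 0, 1, 1, 1; 0, 1, 1, 0, 0, 1]

def Q4 : Config := conf !![0; 0; 0]

def Q5 : Config := conf !![1; 1; 1]

def Q6 : Config := conf !![1, 0, 0; 0, 1, 0; 0, 0, 1]

def Q7 : Config := conf !![0, 1, 1; 1, 0, 1; 1, 1, 0]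

def Q8 : Config := conf !![1, 0, 1, 0; 0, 1, 0, 1; 0, 0, 1, 1]

def Q9 : Config := conf !![1, 0; 1, 0; 0, 1; 0, 1]

/-- The list of families for which the growth is quadratic. -/
def QuadraticList (ℱ : Set Config) : Prop :=
  ℱ ⊆ {Q1, Q4, Q6} ∨ ℱ ⊆ {Q2, Q5, Q7} ∨ ℱ ⊆ {Q6, Q7, Q8} ∨ ℱ ⊆ {Q6, Q9} ∨ ℱ ⊆ {Q7, Q9} ∨
    ℱ = {Q3}

/-- For some `l`, each of `I_l`, `I_l^c`, `T_l` contains a member of `ℱ`. -/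
def MeetsBasic (ℱ : Set Config) : Prop :=
  ∃ l : ℕ, (∃ F ∈ ℱ, F.In (conf (matI l))) ∧ (∃ F ∈ ℱ, F.In (conf (matIc l))) ∧
    (∃ F ∈ ℱ, F.In (conf (matT l)))

end ForbConf

/-! Columns are read as their supports, so a simple matrix becomes a set family and `Has` expresses
containment of a configuration. Complementation exchanges `Q1` with `Q2`, `Q4` with `Q5`, `Q6` with
`Q7` and fixes `Q3`, `Q8`, `Q9`, which halves the work.

Quadratic lower bounds come from products of two of the matrices I, I^c, T: I×I avoids `Q2`, `Q5`,
`Q7`; T×T avoids `Q6`, `Q7`, `Q8`; I×T avoids `Q7`, `Q9`; I×I^c avoids `Q3`; complements give the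
two remaining lists. For upper bounds, deleting a row `r` loses exactly `#(link r 𝒜)` columns, so
bounded links give linear families and linear links give quadratic ones (`card_le_of_link`). Sauer's
bound covers `Q6`, `Q7`, `Q8`.

A family outside the quadratic list contains one of a few small combinations
(`mem_of_not_quadraticList`), and avoiding `Q4` or `Q5` implies avoiding `Q1` or `Q2`. Avoiding `Q2`
means that two columns share at most one 1, and degree counting finishes. Avoiding `Q3` makes each
row of a link almost constant. If moreover `Q6` or `Q9` is avoided and all links are large, then
each row claims rows of its own, and the disjoint claims exceed the number of rows (for `Q9`, after
sorting the rows into two classes). If `Q9` is avoided together with `Q8`, or with both `Q6` and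
`Q7`, then links with three members are chains, and their middle members have distinct sizes in too
short an interval (`ChainLike.card_le`).

If the condition `MeetsBasic` fails, then one of I, I^c, T is itself a matrix with `m` columns in
the class. If it holds, `forb` is at most 15, and it is eventually nondecreasing since a row
repeated often enough can be duplicated once more (`Avoids.duplicate_row`); so it stabilises. -/

namespace ForbConf

open Finset
open scoped FinsetFamily

/-! ### Set families, configurations in them, and induction on rows -/

section Families

variable {α : Type*}

/-- The matrix `M` occurs, up to row and column permutations, as a submatrix of the incidence
matrix of the family `𝒜`, whose members are the supports of the columns. -/
def HasMat {k l : ℕ} (M : Matrix (Fin k) (Fin l) (Fin 2)) (𝒜 : Finset (Finset α)) : Prop :=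
  ∃ (f : Fin k → α) (g : Fin l → Finset α), Function.Injective f ∧ Function.Injective g ∧
    (∀ c, g c ∈ 𝒜) ∧ ∀ i c, f i ∈ g c ↔ M i c = 1

/-- The configuration `F` occurs in the family `𝒜`. -/
def Has (F : Config) (𝒜 : Finset (Finset α)) : Prop := HasMat F.entry 𝒜

/-- Distinct columns of `M` force distinct representatives, so injectivity of `g` comes for free. -/
theorem HasMat.of_isSimple {k l : ℕ} {M : Matrix (Fin k) (Fin l) (Fin 2)}
    {𝒜 : Finset (Finset α)} (hM : IsSimple M) (f : Fin k → α) (hf : Function.Injective f)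
    (g : Fin l → Finset α) (hg : ∀ c, g c ∈ 𝒜) (he : ∀ i c, f i ∈ g c ↔ M i c = 1) :
    HasMat M 𝒜 := by
  refine ⟨f, g, hf, fun c c' h => hM c c' fun i => ?_, hg, he⟩
  have h1 := he i c
  rw [h, he i c'] at h1
  generalize M i c = a at *
  generalize M i c' = b at *
  revert a b
  decide

theorem injective_vec2 {β : Type*} {x y : β} (hxy : x ≠ y) : Function.Injective ![x, y] := by
  simpa [Function.Injective, Fin.forall_fin_two] using ⟨hxy, hxy.symm⟩

theorem injective_vec3 {β : Type*} {x y z : β} (hxy : x ≠ y) (hxz : x ≠ z) (hyz : y ≠ z) :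
    Function.Injective ![x, y, z] := by
  intro i j
  fin_cases i <;> fin_cases j <;> simp [hxy, hxz, hyz, hxy.symm, hxz.symm, hyz.symm]

theorem has_Q2 {𝒜 : Finset (Finset α)} {A B : Finset α} {x y : α} (hA : A ∈ 𝒜) (hB : B ∈ 𝒜)
    (hAB : A ≠ B) (hxy : x ≠ y) (h1 : x ∈ A) (h2 : y ∈ A) (h3 : x ∈ B) (h4 : y ∈ B) :
    Has Q2 𝒜 := by
  change HasMat !![1, 1; 1, 1] 𝒜
  refine ⟨![x, y], ![A, B], injective_vec2 hxy, injective_vec2 hAB, ?_, ?_⟩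
  · simpa [Fin.forall_fin_two] using ⟨hA, hB⟩
  · simp [Fin.forall_fin_two, *]

theorem has_Q6 {𝒜 : Finset (Finset α)} {A B C : Finset α} {x y z : α}
    (hA : A ∈ 𝒜) (hB : B ∈ 𝒜) (hC : C ∈ 𝒜)
    (xA : x ∈ A) (yA : y ∉ A) (zA : z ∉ A) (xB : x ∉ B) (yB : y ∈ B) (zB : z ∉ B)
    (xC : x ∉ C) (yC : y ∉ C) (zC : z ∈ C) : Has Q6 𝒜 := by
  change HasMat !![1, 0, 0; 0, 1, 0; 0, 0, 1] 𝒜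
  have hxy : x ≠ y := fun h => yA (h ▸ xA)
  have hxz : x ≠ z := fun h => zA (h ▸ xA)
  have hyz : y ≠ z := fun h => zB (h ▸ yB)
  refine HasMat.of_isSimple (by unfold IsSimple; decide) ![x, y, z] (injective_vec3 hxy hxz hyz)
    ![A, B, C] ?_ ?_
  · intro i; fin_cases i <;> simpa
  · intro i j; fin_cases i <;> fin_cases j <;> simp [*]

theorem has_Q7 {𝒜 : Finset (Finset α)} {A B C : Finset α} {x y z : α}
    (hA : A ∈ 𝒜) (hB : B ∈ 𝒜) (hC : C ∈ 𝒜)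
    (xA : x ∉ A) (yA : y ∈ A) (zA : z ∈ A) (xB : x ∈ B) (yB : y ∉ B) (zB : z ∈ B)
    (xC : x ∈ C) (yC : y ∈ C) (zC : z ∉ C) : Has Q7 𝒜 := by
  change HasMat !![0, 1, 1; 1, 0, 1; 1, 1, 0] 𝒜
  have hxy : x ≠ y := fun h => xA (h ▸ yA)
  have hxz : x ≠ z := fun h => xA (h ▸ zA)
  have hyz : y ≠ z := fun h => yB (h ▸ zB)
  refine HasMat.of_isSimple (by unfold IsSimple; decide) ![x, y, z] (injective_vec3 hxy hxz hyz)
    ![A, B, C] ?_ ?_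
  · intro i; fin_cases i <;> simpa
  · intro i j; fin_cases i <;> fin_cases j <;> simp [*]

theorem has_Q8 {𝒜 : Finset (Finset α)} {A B C D : Finset α} {x y z : α}
    (hA : A ∈ 𝒜) (hB : B ∈ 𝒜) (hC : C ∈ 𝒜) (hD : D ∈ 𝒜)
    (xA : x ∈ A) (yA : y ∉ A) (zA : z ∉ A) (xB : x ∉ B) (yB : y ∈ B) (zB : z ∉ B)
    (xC : x ∈ C) (yC : y ∉ C) (zC : z ∈ C) (xD : x ∉ D) (yD : y ∈ D) (zD : z ∈ D) :
    Has Q8 𝒜 := by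
  change HasMat !![1, 0, 1, 0; 0, 1, 0, 1; 0, 0, 1, 1] 𝒜
  have hxy : x ≠ y := fun h => yA (h ▸ xA)
  have hxz : x ≠ z := fun h => zA (h ▸ xA)
  have hyz : y ≠ z := fun h => zB (h ▸ yB)
  refine HasMat.of_isSimple (by unfold IsSimple; decide) ![x, y, z] (injective_vec3 hxy hxz hyz)
    ![A, B, C, D] ?_ ?_
  · intro i; fin_cases i <;> simpa
  · intro i j; fin_cases i <;> fin_cases j <;> simp [*]

theorem has_Q9 {𝒜 : Finset (Finset α)} {A B : Finset α} {x y z w : α}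
    (hA : A ∈ 𝒜) (hB : B ∈ 𝒜) (hxy : x ≠ y) (hzw : z ≠ w)
    (xA : x ∈ A) (yA : y ∈ A) (zA : z ∉ A) (wA : w ∉ A)
    (xB : x ∉ B) (yB : y ∉ B) (zB : z ∈ B) (wB : w ∈ B) : Has Q9 𝒜 := by
  change HasMat !![1, 0; 1, 0; 0, 1; 0, 1] 𝒜
  have hxz : x ≠ z := fun h => zA (h ▸ xA)
  have hxw : x ≠ w := fun h => wA (h ▸ xA)
  have hyz : y ≠ z := fun h => zA (h ▸ yA)
  have hyw : y ≠ w := fun h => wA (h ▸ yA)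
  refine HasMat.of_isSimple (by unfold IsSimple; decide) ![x, y, z, w] ?_ ![A, B] ?_ ?_
  · intro i j
    fin_cases i <;> fin_cases j <;>
      simp [hxy, hxz, hyz, hxw, hyw, hzw, hxy.symm, hxz.symm, hyz.symm, hxw.symm, hyw.symm,
        hzw.symm]
  · intro i; fin_cases i <;> simpa
  · intro i j; fin_cases i <;> fin_cases j <;> simp [*]

/-- `Q3` has two pairs of equal columns; only these need a distinctness hypothesis, all other pairs
being separated by `x` or `y`. -/
theorem has_Q3' {𝒜 : Finset (Finset α)} {A B B' C C' D : Finset α} {x y : α}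
    (hA : A ∈ 𝒜) (hB : B ∈ 𝒜) (hB' : B' ∈ 𝒜) (hC : C ∈ 𝒜) (hC' : C' ∈ 𝒜) (hD : D ∈ 𝒜)
    (hBB : B ≠ B') (hCC : C ≠ C')
    (xA : x ∉ A) (yA : y ∉ A) (xB : x ∉ B) (yB : y ∈ B) (xB' : x ∉ B') (yB' : y ∈ B')
    (xC : x ∈ C) (yC : y ∉ C) (xC' : x ∈ C') (yC' : y ∉ C') (xD : x ∈ D) (yD : y ∈ D) :
    Has Q3 𝒜 := by
  change HasMat !![0, 0, 0, 1, 1, 1; 0, 1, 1, 0, 0, 1] 𝒜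
  have hxy : x ≠ y := fun h => xB (h ▸ yB)
  have ne {S T : Finset α} {z : α} (h1 : z ∈ S) (h2 : z ∉ T) : S ≠ T := fun h => h2 (h ▸ h1)
  have e1 := ne yB yA
  have e2 := ne yB' yA
  have e3 := ne xC xA
  have e4 := ne xC' xA
  have e5 := ne xD xA
  have e6 := ne yB yC
  have e7 := ne yB yC'
  have e8 := ne xD xB
  have e9 := ne yB' yC
  have f1 := ne yB' yC'
  have f2 := ne xD xB'
  have f3 := ne yD yC
  have f4 := ne yD yC'
  refine ⟨![x, y], ![A, B, B', C, C', D], injective_vec2 hxy, ?_, ?_, ?_⟩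
  · intro i j
    fin_cases i <;> fin_cases j <;> simp [hBB, hCC, hBB.symm, hCC.symm, e1, e2, e3, e4, e5, e6,
      e7, e8, e9, f1, f2, f3, f4, e1.symm, e2.symm, e3.symm, e4.symm, e5.symm, e6.symm, e7.symm,
      e8.symm, e9.symm, f1.symm, f2.symm, f3.symm, f4.symm]
  · intro i; fin_cases i <;> simpa
  · intro i j; fin_cases i <;> fin_cases j <;> simp [*]

variable [DecidableEq α]

theorem has_Q3 {𝒜 : Finset (Finset α)} {x y : α} (h00 : ∃ A ∈ 𝒜, x ∉ A ∧ y ∉ A)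
    (h01 : 1 < #{A ∈ 𝒜 | x ∉ A ∧ y ∈ A}) (h10 : 1 < #{A ∈ 𝒜 | x ∈ A ∧ y ∉ A})
    (h11 : ∃ A ∈ 𝒜, x ∈ A ∧ y ∈ A) : Has Q3 𝒜 := by
  change HasMat !![0, 0, 0, 1, 1, 1; 0, 1, 1, 0, 0, 1] 𝒜
  obtain ⟨A, hA, xA, yA⟩ := h00
  obtain ⟨D, hD, xD, yD⟩ := h11
  obtain ⟨B, hB, B', hB', hBB⟩ := one_lt_card.1 h01
  obtain ⟨C, hC, C', hC', hCC⟩ := one_lt_card.1 h10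
  simp only [mem_filter] at hB hB' hC hC'
  exact has_Q3' hA hB.1 hB'.1 hC.1 hC'.1 hD hBB hCC xA yA hB.2.1 hB.2.2 hB'.2.1 hB'.2.2
    hC.2.1 hC.2.2 hC'.2.1 hC'.2.2 xD yD

/-- Every row of `M` contains a `1`. -/
def HitsRows {k l : ℕ} (M : Matrix (Fin k) (Fin l) (Fin 2)) : Prop :=
  ∀ i, ∃ c, M i c = 1

instance {k l : ℕ} (M : Matrix (Fin k) (Fin l) (Fin 2)) : Decidable (HitsRows M) :=
  have h (N : Fin k → Fin l → Fin 2) : Decidable (∀ i, ∃ c, N i c = 1) := inferInstance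
  h M

/-- Deleting a row does not create a configuration all of whose rows contain a `1`. -/
theorem Has.of_image_erase {F : Config} (hF : HitsRows F.entry) {r : α}
    {𝒜 : Finset (Finset α)} (h : Has F (𝒜.image (·.erase r))) : Has F 𝒜 := by
  obtain ⟨f, g, hf, hgi, hg, he⟩ := h
  have hr : ∀ i, f i ≠ r := by
    intro i hi
    obtain ⟨c, hc⟩ := hF i
    have h1 := (he i c).2 hc
    obtain ⟨A, -, hA⟩ := mem_image.1 (hg c)
    rw [← hA, hi] at h1
    simp at h1
  choose G hG hGe using fun c => mem_image.1 (hg c)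
  refine ⟨f, G, hf, fun c c' h => hgi ?_, hG, fun i c => ?_⟩
  · rw [← hGe c, ← hGe c', h]
  · rw [← he i c, ← hGe c]
    simp [hr i]

/-- The members of `𝒜` not containing `r` that remain in `𝒜` when `r` is added. -/
def link (r : α) (𝒜 : Finset (Finset α)) : Finset (Finset α) :=
  {A ∈ 𝒜 | insert r A ∈ 𝒜 ∧ r ∉ A}

theorem mem_link {r : α} {𝒜 : Finset (Finset α)} {A : Finset α} :
    A ∈ link r 𝒜 ↔ A ∈ 𝒜 ∧ insert r A ∈ 𝒜 ∧ r ∉ A := by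
  simp [link]

/-- Erasing `r` identifies `A` with `insert r A` and nothing else; the link counts the identified
pairs. -/
theorem card_image_erase_add_card_link (r : α) (𝒜 : Finset (Finset α)) :
    #(𝒜.image (·.erase r)) + #(link r 𝒜) = #𝒜 := by
  rw [← card_memberSubfamily_add_card_nonMemberSubfamily r 𝒜,
    ← card_union_add_card_inter (𝒜.memberSubfamily r), memberSubfamily_union_nonMemberSubfamily]
  congr 2
  ext A
  simp only [mem_link, mem_inter, mem_memberSubfamily, mem_nonMemberSubfamily]
  tauto

/-- Standard induction: delete rows one at a time. -/
theorem card_le_of_link {P : Finset (Finset α) → Prop} {b : ℕ}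
    (hP : ∀ r 𝒜, P 𝒜 → P (𝒜.image (·.erase r)))
    (h : ∀ (U : Finset α) (𝒜 : Finset (Finset α)), U.Nonempty → 𝒜 ⊆ U.powerset → P 𝒜 → ∃ r ∈ U, #(link r 𝒜) ≤ b) (U : Finset α) :
    ∀ 𝒜, 𝒜 ⊆ U.powerset → P 𝒜 → #𝒜 ≤ b * #U + 1 := by
  induction hn : #U generalizing U with
  | zero =>
    intro 𝒜 h𝒜 _
    rw [card_eq_zero] at hn
    subst hn
    simpa using card_le_card h𝒜
  | succ n ih =>
    intro 𝒜 h𝒜 hp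
    obtain ⟨r, hr, hb⟩ := h U 𝒜 (card_pos.1 (by omega)) h𝒜 hp
    have h1 := ih (U.erase r) (by rw [card_erase_of_mem hr, hn]; rfl) (𝒜.image (·.erase r))
      (by
        intro A hA
        obtain ⟨B, hB, rfl⟩ := mem_image.1 hA
        exact mem_powerset.2 (erase_subset_erase r (mem_powerset.1 (h𝒜 hB)))) (hP r 𝒜 hp)
    have h2 := card_image_erase_add_card_link r 𝒜
    rw [mul_add]
    omega

/-- A point chosen in each nonempty member determines it; the empty set accounts for the extra 1. -/
theorem card_le_of_disjoint [Fintype α] {𝒜 : Finset (Finset α)}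
    (h : ∀ A ∈ 𝒜, ∀ B ∈ 𝒜, ∀ x ∈ A, x ∈ B → A = B) : #𝒜 ≤ Fintype.card α + 1 := by
  have h1 : #(𝒜.erase ∅) ≤ Fintype.card α := by
    have h2 : ∀ A ∈ 𝒜.erase ∅, ∃ x, x ∈ A := fun A hA =>
      nonempty_iff_ne_empty.2 (mem_erase.1 hA).1
    choose φ hφ using h2
    rw [← card_attach]
    refine card_le_card_of_injOn (fun A => φ A.1 A.2) (fun _ _ => mem_univ _) ?_
    intro A _ B _ hAB
    refine Subtype.ext (h A (mem_of_mem_erase A.2) B (mem_of_mem_erase B.2) _ (hφ A A.2) ?_)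
    rw [show φ A A.2 = φ B B.2 from hAB]
    exact hφ B B.2
  have := pred_card_le_card_erase (s := 𝒜) (a := ∅)
  omega

/-- A family all of whose nonempty subfamilies have a point of degree between `1` and `k`. -/
theorem card_le_of_degenerate [Fintype α] {𝒜 : Finset (Finset α)} {k : ℕ}
    (h : ∀ ℬ ⊆ 𝒜, ℬ.Nonempty → ∃ x, 1 ≤ #{A ∈ ℬ | x ∈ A} ∧ #{A ∈ ℬ | x ∈ A} ≤ k) :
    #𝒜 ≤ k * Fintype.card α := by
  suffices H : ∀ n, ∀ V : Finset α, #V = n → ∀ ℬ ⊆ 𝒜, ℬ ⊆ V.powerset → #ℬ ≤ k * n from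
    H _ univ rfl 𝒜 subset_rfl (by simp)
  intro n
  induction n with
  | zero =>
    intro V hV ℬ hℬ hs
    by_contra hc
    obtain ⟨x, h1, -⟩ := h ℬ hℬ (card_pos.1 (by omega))
    obtain ⟨A, hA⟩ := card_pos.1 h1
    rw [mem_filter] at hA
    rw [card_eq_zero] at hV
    have := mem_powerset.1 (hs hA.1) hA.2
    simp [hV] at this
  | succ n ih =>
    intro V hV ℬ hℬ hs
    by_cases hne : ℬ.Nonempty
    swap
    · simp [not_nonempty_iff_eq_empty.1 hne]
    obtain ⟨x, h1, h2⟩ := h ℬ hℬ hne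
    obtain ⟨A, hA⟩ := card_pos.1 h1
    rw [mem_filter] at hA
    have hx : x ∈ V := mem_powerset.1 (hs hA.1) hA.2
    have h3 := ih (V.erase x) (by rw [card_erase_of_mem hx]; omega) {A ∈ ℬ | x ∉ A}
      ((filter_subset _ _).trans hℬ) (by
        intro B hB
        rw [mem_filter] at hB
        rw [mem_powerset]
        exact subset_erase.2 ⟨mem_powerset.1 (hs hB.1), hB.2⟩)
    have h4 := card_filter_add_card_filter_not (s := ℬ) (fun A => x ∈ A)
    rw [mul_add]
    omega

end Families

/-! ### Families avoiding `Q2` and one more configuration -/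

section UpperBounds

variable {α : Type*}

theorem card_split_card_le_one (𝒜 : Finset (Finset α)) :
    #𝒜 = #{A ∈ 𝒜 | #A ≤ 1} + #{A ∈ 𝒜 | 1 < #A} := by
  rw [← card_filter_add_card_filter_not (s := 𝒜) (fun A => #A ≤ 1)]
  simp

theorem not_has_mono {F : Config} {𝒜 ℬ : Finset (Finset α)} (h : ℬ ⊆ 𝒜) (h𝒜 : ¬ Has F 𝒜) :
    ¬ Has F ℬ :=
  fun ⟨f, g, hf, hgi, hg, he⟩ => h𝒜 ⟨f, g, hf, hgi, fun c => h (hg c), he⟩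

variable [DecidableEq α]

theorem eq_of_not_has_Q2 {𝒜 : Finset (Finset α)} (h : ¬ Has Q2 𝒜) {A B : Finset α} {x y : α}
    (hA : A ∈ 𝒜) (hB : B ∈ 𝒜) (xA : x ∈ A) (yA : y ∈ A) (xB : x ∈ B) (yB : y ∈ B)
    (hxy : x ≠ y) : A = B := by
  by_contra hAB
  exact h (has_Q2 hA hB hAB hxy xA yA xB yB)

theorem card_filter_card_le_one [Fintype α] (𝒜 : Finset (Finset α)) :
    #{A ∈ 𝒜 | #A ≤ 1} ≤ Fintype.card α + 1 := by
  refine card_le_of_disjoint fun A hA B hB x xA xB => ?_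
  rw [mem_filter] at hA hB
  rw [eq_singleton_iff_unique_mem.2 ⟨xA, fun y hy => card_le_one.1 hA.2 y hy x xA⟩,
    eq_singleton_iff_unique_mem.2 ⟨xB, fun y hy => card_le_one.1 hB.2 y hy x xB⟩]

/-- Once `x` is erased, the members through `x` are pairwise disjoint. -/
theorem card_filter_mem_le_of_not_has_Q2 [Fintype α] {𝒜 : Finset (Finset α)} (h : ¬ Has Q2 𝒜)
    (x : α) : #{A ∈ 𝒜 | x ∈ A} ≤ Fintype.card α + 1 := by
  have h1 : #({A ∈ 𝒜 | x ∈ A}.image (·.erase x)) = #{A ∈ 𝒜 | x ∈ A} := by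
    refine card_image_of_injOn fun A hA B hB hAB => ?_
    simp only [coe_filter, Set.mem_ofPred_eq] at hA hB
    rw [← insert_erase hA.2, ← insert_erase hB.2, show A.erase x = B.erase x from hAB]
  rw [← h1]
  refine card_le_of_disjoint ?_
  simp only [mem_image, mem_filter]
  rintro _ ⟨A, ⟨hA, xA⟩, rfl⟩ _ ⟨B, ⟨hB, xB⟩, rfl⟩ y hy hy'
  rw [mem_erase] at hy hy'
  rw [eq_of_not_has_Q2 h hA hB xA hy.2 xB hy'.2 hy.1.symm]

theorem card_filter_mem_and_mem_le_one {𝒜 : Finset (Finset α)} (h : ¬ Has Q2 𝒜) {x y : α}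
    (hxy : x ≠ y) : #{A ∈ 𝒜 | x ∈ A ∧ y ∈ A} ≤ 1 := by
  refine card_le_one.2 fun A hA B hB => ?_
  simp only [mem_filter] at hA hB
  exact eq_of_not_has_Q2 h hA.1 hB.1 hA.2.1 hA.2.2 hB.2.1 hB.2.2 hxy

theorem card_filter_mem_eq (𝒜 : Finset (Finset α)) (x y : α) :
    #{A ∈ 𝒜 | x ∈ A} = #{A ∈ 𝒜 | x ∈ A ∧ y ∈ A} + #{A ∈ 𝒜 | x ∈ A ∧ y ∉ A} := by
  rw [← card_filter_add_card_filter_not (s := {A ∈ 𝒜 | x ∈ A}) (fun A => y ∈ A), filter_filter,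
    filter_filter]

/-- If a member contains two points of degree at least 3, a member missing both would complete `Q3`,
so the two stars cover the family. Otherwise each member with two points has a point of degree at
most 2, and the large members are degenerate. -/
theorem card_le_of_not_has_Q2_Q3 [Fintype α] {𝒜 : Finset (Finset α)} (h2 : ¬ Has Q2 𝒜)
    (h3 : ¬ Has Q3 𝒜) : #𝒜 ≤ 3 * (Fintype.card α + 1) := by
  by_cases hc : ∃ A ∈ 𝒜, ∃ x ∈ A, ∃ y ∈ A, x ≠ y ∧ 2 < #{A ∈ 𝒜 | x ∈ A} ∧ 2 < #{A ∈ 𝒜 | y ∈ A}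
  · obtain ⟨A, hA, x, xA, y, yA, hxy, hx, hy⟩ := hc
    have hcover : 𝒜 ⊆ {A ∈ 𝒜 | x ∈ A} ∪ {A ∈ 𝒜 | y ∈ A} := by
      intro B hB
      simp only [mem_union, mem_filter]
      by_contra hcon
      refine h3 (has_Q3 (x := x) (y := y) ⟨B, hB, by tauto⟩ ?_ ?_ ⟨A, hA, xA, yA⟩)
      · have h1 := card_filter_mem_eq 𝒜 y x
        have h4 := card_filter_mem_and_mem_le_one h2 hxy.symm
        simp only [and_comm (a := x ∉ _)]
        omega
      · have h1 := card_filter_mem_eq 𝒜 x y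
        have h4 := card_filter_mem_and_mem_le_one h2 hxy
        omega
    have h1 := (card_le_card hcover).trans (card_union_le _ _)
    have h4 := card_filter_mem_le_of_not_has_Q2 h2 x
    have h5 := card_filter_mem_le_of_not_has_Q2 h2 y
    omega
  · push Not at hc
    have h1 : #{A ∈ 𝒜 | 1 < #A} ≤ 2 * Fintype.card α := by
      refine card_le_of_degenerate fun ℬ hℬ ⟨B, hB⟩ => ?_
      have hB' := mem_filter.1 (hℬ hB)
      obtain ⟨x, xB, y, yB, hxy⟩ := one_lt_card.1 hB'.2
      have hℬ' : ℬ ⊆ 𝒜 := hℬ.trans (filter_subset _ _)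
      have hle (z) : #{A ∈ ℬ | z ∈ A} ≤ #{A ∈ 𝒜 | z ∈ A} :=
        card_le_card (filter_subset_filter _ hℬ')
      have hpos {z} (hz : z ∈ B) : 1 ≤ #{A ∈ ℬ | z ∈ A} :=
        card_pos.2 ⟨B, mem_filter.2 ⟨hB, hz⟩⟩
      by_cases hx : 2 < #{A ∈ 𝒜 | x ∈ A}
      · exact ⟨y, hpos yB, (hle y).trans (hc B hB'.1 x xB y yB hxy hx)⟩
      · exact ⟨x, hpos xB, (hle x).trans (by omega)⟩
    have h4 := card_filter_card_le_one 𝒜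
    have h5 := card_split_card_le_one 𝒜
    omega

/-- If all positive degrees exceed 2, a path of members `A`, `C`, `D`, `B`, consecutive ones meeting
in `x`, `z`, `y`, can be grown greedily; on these three rows it is `Q8`. -/
theorem card_le_of_not_has_Q2_Q8 [Fintype α] {𝒜 : Finset (Finset α)} (h2 : ¬ Has Q2 𝒜)
    (h8 : ¬ Has Q8 𝒜) : #𝒜 ≤ 3 * (Fintype.card α + 1) := by
  have h1 : #{A ∈ 𝒜 | 1 < #A} ≤ 2 * Fintype.card α := by
    refine card_le_of_degenerate fun ℬ hℬ ⟨C, hC⟩ => ?_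
    have hC' := mem_filter.1 (hℬ hC)
    have hℬ' : ℬ ⊆ 𝒜 := hℬ.trans (filter_subset _ _)
    have h2' := not_has_mono hℬ' h2
    by_contra! hcon
    have hdeg {x A} (hA : A ∈ ℬ) (hx : x ∈ A) : 2 < #{A ∈ ℬ | x ∈ A} :=
      hcon x (card_pos.2 ⟨A, mem_filter.2 ⟨hA, hx⟩⟩)
    -- a set through `x` avoiding `y` and different from `C`
    have hext {x y C} (hC : C ∈ ℬ) (hx : x ∈ C) (hxy : x ≠ y) :
        ∃ A ∈ ℬ, x ∈ A ∧ y ∉ A ∧ A ≠ C := by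
      have h3 := hdeg hC hx
      rw [card_filter_mem_eq ℬ x y] at h3
      have h4 := card_filter_mem_and_mem_le_one h2' hxy
      obtain ⟨A, hA, hAC⟩ := exists_mem_ne (s := {A ∈ ℬ | x ∈ A ∧ y ∉ A}) (by omega) C
      rw [mem_filter] at hA
      exact ⟨A, hA.1, hA.2.1, hA.2.2, hAC⟩
    obtain ⟨x, xC, z, zC, hxz⟩ := one_lt_card.1 hC'.2
    obtain ⟨D, hD, zD, xD, hDC⟩ := hext hC zC hxz.symm
    obtain ⟨y, yD, hyz⟩ := exists_mem_ne (mem_filter.1 (hℬ hD)).2 z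
    have yC : y ∉ C := fun yC => hDC (eq_of_not_has_Q2 h2' hD hC yD zD yC zC hyz)
    have hxy : x ≠ y := fun h => yC (h ▸ xC)
    obtain ⟨A, hA, xA, yA, hAC⟩ := hext hC xC hxy
    obtain ⟨B, hB, yB, xB, hBD⟩ := hext hD yD hxy.symm
    have zA : z ∉ A := fun zA => hAC (eq_of_not_has_Q2 h2' hA hC xA zA xC zC hxz)
    have zB : z ∉ B := fun zB => hBD (eq_of_not_has_Q2 h2' hB hD yB zB yD zD hyz)
    exact not_has_mono hℬ' h8
      (has_Q8 hA hB hC hD xA yA zA xB yB zB xC yC zC xD yD zD)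
  have h4 := card_filter_card_le_one 𝒜
  have h5 := card_split_card_le_one 𝒜
  omega

/-- A two-point member must meet every member with at least two points. Without such a member, two
sets of size at least 3 sharing at most one point already form `Q9`. -/
theorem card_le_of_not_has_Q2_Q9 [Fintype α] {𝒜 : Finset (Finset α)} (h2 : ¬ Has Q2 𝒜)
    (h9 : ¬ Has Q9 𝒜) : #𝒜 ≤ 3 * (Fintype.card α + 1) := by
  have h4 := card_filter_card_le_one 𝒜
  have h5 := card_split_card_le_one 𝒜
  suffices #{A ∈ 𝒜 | 1 < #A} ≤ 2 * (Fintype.card α + 1) by omega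
  by_cases hc : ∃ A ∈ 𝒜, #A = 2
  · obtain ⟨A, hA, hA2⟩ := hc
    obtain ⟨x, y, hxy, rfl⟩ := card_eq_two.1 hA2
    have hcover : {A ∈ 𝒜 | 1 < #A} ⊆ {A ∈ 𝒜 | x ∈ A} ∪ {A ∈ 𝒜 | y ∈ A} := by
      intro B hB
      simp only [mem_union, mem_filter] at hB ⊢
      by_contra hcon
      obtain ⟨z, zB, w, wB, hzw⟩ := one_lt_card.1 hB.2
      have hz : x ∉ B := by tauto
      have hw : y ∉ B := by tauto
      have aux {u} (hu : u ∈ B) : u ∉ ({x, y} : Finset α) := by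
        simp only [mem_insert, mem_singleton]
        rintro (rfl | rfl) <;> contradiction
      exact h9 (has_Q9 hA hB.1 hxy hzw (by simp) (by simp) (aux zB) (aux wB) hz hw zB wB)
    have h1 := (card_le_card hcover).trans (card_union_le _ _)
    have h4 := card_filter_mem_le_of_not_has_Q2 h2 x
    have h5 := card_filter_mem_le_of_not_has_Q2 h2 y
    omega
  · push Not at hc
    refine le_trans (card_le_one.2 fun A hA B hB => ?_) (by omega : 1 ≤ _)
    rw [mem_filter] at hA hB
    by_contra hAB
    have hA3 : 3 ≤ #A := by have := hc A hA.1; omega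
    have hB3 : 3 ≤ #B := by have := hc B hB.1; omega
    have hI : #(A ∩ B) ≤ 1 := by
      refine card_le_one.2 fun x hx y hy => ?_
      rw [mem_inter] at hx hy
      by_contra hxy
      exact hAB (eq_of_not_has_Q2 h2 hA.1 hB.1 hx.1 hy.1 hx.2 hy.2 hxy)
    have h1 := card_sdiff_add_card_inter A B
    have h3 := card_sdiff_add_card_inter B A
    rw [inter_comm] at h3
    obtain ⟨x, hx, y, hy, hxy⟩ := one_lt_card.1 (show 1 < #(A \ B) by omega)
    obtain ⟨z, hz, w, hw, hzw⟩ := one_lt_card.1 (show 1 < #(B \ A) by omega)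
    rw [Finset.mem_sdiff] at hx hy hz hw
    exact h9 (has_Q9 hA.1 hB.1 hxy hzw hx.1 hy.1 hz.2 hw.2 hx.2 hy.2 hz.1 hw.1)

theorem card_le_of_not_has_Q2_Q6 {𝒜 : Finset (Finset α)} (h2 : ¬ Has Q2 𝒜)
    (h6 : ¬ Has Q6 𝒜) : #𝒜 ≤ 15 := by
  -- Three such members pairwise meet only in `x`, so their other points give `Q6`.
  have hdeg2 (x : α) : #{A ∈ 𝒜 | x ∈ A ∧ 1 < #A} ≤ 2 := by
    by_contra! hcon
    obtain ⟨A, B, C, hA, hB, hC, hAB, hAC, hBC⟩ := two_lt_card_iff.1 hcon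
    simp only [mem_filter] at hA hB hC
    obtain ⟨a, aA, hax⟩ := exists_mem_ne hA.2.2 x
    obtain ⟨b, bB, hbx⟩ := exists_mem_ne hB.2.2 x
    obtain ⟨c, cC, hcx⟩ := exists_mem_ne hC.2.2 x
    have aux {S T u} (hS : S ∈ 𝒜 ∧ x ∈ S ∧ 1 < #S) (hT : T ∈ 𝒜 ∧ x ∈ T ∧ 1 < #T) (hST : S ≠ T)
        (hu : u ∈ S) (hux : u ≠ x) : u ∉ T :=
      fun h => hST (eq_of_not_has_Q2 h2 hS.1 hT.1 hu hS.2.1 h hT.2.1 hux)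
    exact h6 (has_Q6 hA.1 hB.1 hC.1 aA (aux hB hA hAB.symm bB hbx) (aux hC hA hAC.symm cC hcx)
      (aux hA hB hAB aA hax) bB (aux hC hB hBC.symm cC hcx) (aux hA hC hAC aA hax)
      (aux hB hC hBC bB hbx) cC)
  have hdeg (x : α) : #{A ∈ 𝒜 | x ∈ A} ≤ 3 := by
    have h1 : {A ∈ 𝒜 | x ∈ A} ⊆ insert {x} {A ∈ 𝒜 | x ∈ A ∧ 1 < #A} := by
      intro A hA
      rw [mem_filter] at hA
      rw [mem_insert, mem_filter]
      by_cases h : 1 < #A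
      · exact .inr ⟨hA.1, hA.2, h⟩
      · exact .inl (eq_singleton_iff_unique_mem.2
          ⟨hA.2, fun y hy => card_le_one.1 (not_lt.1 h) y hy x hA.2⟩)
    have := (card_le_card h1).trans (card_insert_le _ _)
    have := hdeg2 x
    omega
  -- A set of size at least 3 loses at most one point to each of two others, so each of three such
  -- sets keeps a point of its own.
  have hbig : #{A ∈ 𝒜 | 2 < #A} ≤ 2 := by
    by_contra! hcon
    obtain ⟨A, B, C, hA, hB, hC, hAB, hAC, hBC⟩ := two_lt_card_iff.1 hcon
    simp only [mem_filter] at hA hB hC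
    have aux {S T U} (hS : S ∈ 𝒜 ∧ 2 < #S) (hT : T ∈ 𝒜 ∧ 2 < #T) (hU : U ∈ 𝒜 ∧ 2 < #U)
        (hST : S ≠ T) (hSU : S ≠ U) : ∃ u ∈ S, u ∉ T ∧ u ∉ U := by
      by_contra! hcov
      have hsub : S ⊆ (S ∩ T) ∪ (S ∩ U) := by
        intro u hu
        rw [mem_union, mem_inter, mem_inter]
        by_cases huT : u ∈ T
        · exact .inl ⟨hu, huT⟩
        · exact .inr ⟨hu, hcov u hu huT⟩
      have h1 := (card_le_card hsub).trans (card_union_le _ _)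
      have h3 {T} (hT : T ∈ 𝒜) (hST : S ≠ T) : #(S ∩ T) ≤ 1 := by
        refine card_le_one.2 fun x hx y hy => ?_
        rw [mem_inter] at hx hy
        by_contra hxy
        exact hST (eq_of_not_has_Q2 h2 hS.1 hT hx.1 hy.1 hx.2 hy.2 hxy)
      have := h3 hT.1 hST
      have := h3 hU.1 hSU
      omega
    obtain ⟨a, aA, aB, aC⟩ := aux hA hB hC hAB hAC
    obtain ⟨b, bB, bA, bC⟩ := aux hB hA hC hAB.symm hBC
    obtain ⟨c, cC, cA, cB⟩ := aux hC hA hB hAC.symm hBC.symm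
    exact h6 (has_Q6 hA.1 hB.1 hC.1 aA bA cA aB bB cB aC bC cC)
  have hmeet {A : Finset α} (hA : #A ≤ 2) : #{B ∈ 𝒜 | ¬ Disjoint A B} ≤ 6 := by
    have h1 : {B ∈ 𝒜 | ¬ Disjoint A B} ⊆ A.biUnion fun x => {B ∈ 𝒜 | x ∈ B} := by
      intro B hB
      rw [mem_filter, not_disjoint_iff] at hB
      obtain ⟨hB, x, xA, xB⟩ := hB
      exact mem_biUnion.2 ⟨x, xA, mem_filter.2 ⟨hB, xB⟩⟩
    have := (card_le_card h1).trans (card_biUnion_le_card_mul _ _ 3 fun x _ => hdeg x)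
    omega
  -- A small member meets at most 2 · 3 members, so 13 of them would contain three pairwise disjoint
  -- ones, hence `Q6`.
  have hsmall : #{A ∈ 𝒜 | #A ≤ 2 ∧ A.Nonempty} ≤ 12 := by
    by_contra! hcon
    obtain ⟨A, hA⟩ := card_pos.1 (Nat.zero_lt_of_lt hcon)
    have hA' := hA
    rw [mem_filter] at hA'
    set 𝒮 := {A ∈ 𝒜 | #A ≤ 2 ∧ A.Nonempty} with h𝒮
    have h1 := card_filter_add_card_filter_not (s := 𝒮) (fun B => Disjoint A B)
    have h3 : #{B ∈ 𝒮 | ¬ Disjoint A B} ≤ 6 :=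
      (card_le_card (filter_subset_filter _ (filter_subset _ _))).trans (hmeet hA'.2.1)
    obtain ⟨B, hB⟩ := card_pos.1 (show 0 < #{B ∈ 𝒮 | Disjoint A B} by omega)
    have hB' := mem_filter.1 (mem_filter.1 hB).1
    have h4 := card_filter_add_card_filter_not (s := {B ∈ 𝒮 | Disjoint A B})
      (fun C => Disjoint B C)
    have h5 : #{C ∈ {B ∈ 𝒮 | Disjoint A B} | ¬ Disjoint B C} ≤ 6 :=
      (card_le_card (filter_subset_filter _ ((filter_subset _ _).trans (filter_subset _ _)))).trans
        (hmeet hB'.2.1)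
    obtain ⟨C, hC⟩ := card_pos.1 (show 0 < #{C ∈ {B ∈ 𝒮 | Disjoint A B} | Disjoint B C} by omega)
    simp only [mem_filter] at hC hB
    have hC' := mem_filter.1 hC.1.1
    obtain ⟨a, aA⟩ := hA'.2.2
    obtain ⟨b, bB⟩ := hB'.2.2
    obtain ⟨c, cC⟩ := hC'.2.2
    have hAB := disjoint_left.1 hB.2
    have hAC := disjoint_left.1 hC.1.2
    have hBC := disjoint_left.1 hC.2
    exact h6 (has_Q6 hA'.1 hB'.1 hC'.1 aA (fun h => hAB h bB) (fun h => hAC h cC)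
      (hAB aA) bB (fun h => hBC h cC) (hAC aA) (hBC bB) cC)
  have hcover : 𝒜 ⊆ insert ∅ ({A ∈ 𝒜 | 2 < #A} ∪ {A ∈ 𝒜 | #A ≤ 2 ∧ A.Nonempty}) := by
    intro A hA
    simp only [mem_insert, mem_union, mem_filter]
    rcases A.eq_empty_or_nonempty with h | h
    · exact .inl h
    · rcases lt_or_ge 2 #A with h' | h'
      · exact .inr (.inl ⟨hA, h'⟩)
      · exact .inr (.inr ⟨hA, h', h⟩)
  have h1 := (card_le_card hcover).trans ((card_insert_le _ _).trans
    (Nat.add_le_add_right (card_union_le _ _) 1))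
  omega

/-- Every row of the link is almost constant. -/
theorem link_card_le_one_or_of_not_has_Q3 {𝒜 : Finset (Finset α)} (h3 : ¬ Has Q3 𝒜) (r s : α)
    (hrs : r ≠ s) : #{A ∈ link r 𝒜 | s ∉ A} ≤ 1 ∨ #{A ∈ link r 𝒜 | s ∈ A} ≤ 1 := by
  by_contra! hcon
  obtain ⟨A, hA, A', hA', hAA⟩ := one_lt_card.1 hcon.1
  obtain ⟨B, hB, B', hB', hBB⟩ := one_lt_card.1 hcon.2
  simp only [mem_filter, mem_link] at hA hA' hB hB'
  have hins {C D : Finset α} (hC : r ∉ C) (hD : r ∉ D) (hCD : C ≠ D) : insert r C ≠ insert r D :=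
    fun h => hCD (by rw [← erase_insert hC, ← erase_insert hD, h])
  exact h3 (has_Q3' (x := r) (y := s) hA.1.1 hB.1.1 hB'.1.1 hA.1.2.1 hA'.1.2.1 hB.1.2.1 hBB
    (hins hA.1.2.2 hA'.1.2.2 hAA) hA.1.2.2 hA.2 hB.1.2.2 hB.2 hB'.1.2.2 hB'.2
    (mem_insert_self _ _) (by simp [hA.2, hrs.symm]) (mem_insert_self _ _)
    (by simp [hA'.2, hrs.symm]) (mem_insert_self _ _) (by simp [hB.2]))

end UpperBounds

/-! ### Complementation -/

section Complement

variable {α : Type*} [DecidableEq α] [Fintype α]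

/-- `M'` is the complement of `M` with columns permuted by `e`. -/
def IsComplOf {k l : ℕ} (M M' : Matrix (Fin k) (Fin l) (Fin 2)) (e : Fin l ≃ Fin l) : Prop :=
  ∀ i c, M' i c = 1 ↔ M i (e c) ≠ 1

instance {k l : ℕ} (M M' : Matrix (Fin k) (Fin l) (Fin 2)) (e : Fin l ≃ Fin l) :
    Decidable (IsComplOf M M' e) :=
  have h (N N' : Fin k → Fin l → Fin 2) : Decidable (∀ i c, N' i c = 1 ↔ N i (e c) ≠ 1) :=
    inferInstance
  h M M'

theorem HasMat.of_compls {k l : ℕ} {M M' : Matrix (Fin k) (Fin l) (Fin 2)}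
    {𝒜 : Finset (Finset α)} (e : Fin l ≃ Fin l) (h : IsComplOf M M' e)
    (hM : HasMat M 𝒜ᶜˢ) : HasMat M' 𝒜 := by
  obtain ⟨f, g, hf, hgi, hg, he⟩ := hM
  refine ⟨f, fun c => (g (e c))ᶜ, hf, compl_injective.comp (hgi.comp e.injective),
    fun c => mem_compls.1 (hg _), fun i c => ?_⟩
  rw [mem_compl, h, he]

theorem not_has_Q2_compls {𝒜 : Finset (Finset α)} (h : ¬ Has Q1 𝒜) : ¬ Has Q2 𝒜ᶜˢ := fun h' =>
  h (HasMat.of_compls (M := !![1, 1; 1, 1]) (M' := !![0, 0; 0, 0]) (Equiv.refl _)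
    (by decide) h')

theorem not_has_Q1_compls {𝒜 : Finset (Finset α)} (h : ¬ Has Q2 𝒜) : ¬ Has Q1 𝒜ᶜˢ := fun h' =>
  h (HasMat.of_compls (M := !![0, 0; 0, 0]) (M' := !![1, 1; 1, 1]) (Equiv.refl _)
    (by decide) h')

theorem not_has_Q3_compls {𝒜 : Finset (Finset α)} (h : ¬ Has Q3 𝒜) : ¬ Has Q3 𝒜ᶜˢ := fun h' =>
  h (HasMat.of_compls (M := !![0, 0, 0, 1, 1, 1; 0, 1, 1, 0, 0, 1])
    (M' := !![0, 0, 0, 1, 1, 1; 0, 1, 1, 0, 0, 1]) Fin.revPerm (by decide) h')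

theorem not_has_Q5_compls {𝒜 : Finset (Finset α)} (h : ¬ Has Q4 𝒜) : ¬ Has Q5 𝒜ᶜˢ := fun h' =>
  h (HasMat.of_compls (M := !![1; 1; 1]) (M' := !![0; 0; 0]) (Equiv.refl _)
    (by decide) h')

theorem not_has_Q4_compls {𝒜 : Finset (Finset α)} (h : ¬ Has Q5 𝒜) : ¬ Has Q4 𝒜ᶜˢ := fun h' =>
  h (HasMat.of_compls (M := !![0; 0; 0]) (M' := !![1; 1; 1]) (Equiv.refl _)
    (by decide) h')

theorem not_has_Q6_compls {𝒜 : Finset (Finset α)} (h : ¬ Has Q7 𝒜) : ¬ Has Q6 𝒜ᶜˢ := fun h' =>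
  h (HasMat.of_compls (M := !![1, 0, 0; 0, 1, 0; 0, 0, 1]) (M' := !![0, 1, 1; 1, 0, 1; 1, 1, 0])
    (Equiv.refl _) (by decide) h')

theorem not_has_Q7_compls {𝒜 : Finset (Finset α)} (h : ¬ Has Q6 𝒜) : ¬ Has Q7 𝒜ᶜˢ := fun h' =>
  h (HasMat.of_compls (M := !![0, 1, 1; 1, 0, 1; 1, 1, 0]) (M' := !![1, 0, 0; 0, 1, 0; 0, 0, 1])
    (Equiv.refl _) (by decide) h')

theorem not_has_Q8_compls {𝒜 : Finset (Finset α)} (h : ¬ Has Q8 𝒜) : ¬ Has Q8 𝒜ᶜˢ := fun h' =>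
  h (HasMat.of_compls (M := !![1, 0, 1, 0; 0, 1, 0, 1; 0, 0, 1, 1])
    (M' := !![1, 0, 1, 0; 0, 1, 0, 1; 0, 0, 1, 1]) Fin.revPerm (by decide) h')

theorem not_has_Q9_compls {𝒜 : Finset (Finset α)} (h : ¬ Has Q9 𝒜) : ¬ Has Q9 𝒜ᶜˢ := fun h' =>
  h (HasMat.of_compls (M := !![1, 0; 1, 0; 0, 1; 0, 1]) (M' := !![1, 0; 1, 0; 0, 1; 0, 1])
    Fin.revPerm (by decide) h')

end Complement

/-! ### Links of `Q3`-free families; `Q3` with `Q8` or `Q6` -/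

section UpperBounds

variable {α : Type*}

/-- If members of different sizes are comparable, many sizes give a long chain. -/
theorem exists_strictMono_of_le_card_image {ℒ : Finset (Finset α)} {n : ℕ}
    (h : ∀ A ∈ ℒ, ∀ B ∈ ℒ, #A < #B → A ⊆ B) (hn : n ≤ #(ℒ.image card)) :
    ∃ g : Fin n → Finset α, StrictMono g ∧ ∀ i, g i ∈ ℒ := by
  have h1 := fun i => mem_image.1 (orderEmbOfCardLe_mem (ℒ.image card) hn i)
  choose g hg hgc using h1
  refine ⟨g, fun i j hij => ?_, hg⟩
  have hlt : #(g i) < #(g j) := by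
    rw [hgc, hgc]
    exact (orderEmbOfCardLe _ hn).strictMono hij
  exact (h _ (hg i) _ (hg j) hlt).ssubset_of_ne fun h => by rw [h] at hlt; exact lt_irrefl _ hlt

theorem exists_strictMono_of_chain {ℒ : Finset (Finset α)} {n : ℕ}
    (h : ∀ A ∈ ℒ, ∀ B ∈ ℒ, A ⊆ B ∨ B ⊆ A) (hn : n ≤ #ℒ) :
    ∃ g : Fin n → Finset α, StrictMono g ∧ ∀ i, g i ∈ ℒ := by
  refine exists_strictMono_of_le_card_image (fun A hA B hB hAB => ?_) (hn.trans_eq ?_)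
  · rcases h A hA B hB with h | h
    · exact h
    · exact absurd (card_le_card h) (by omega)
  · refine (card_image_of_injOn fun A hA B hB hAB => ?_).symm
    rcases h A hA B hB with h | h
    · exact eq_of_subset_of_card_le h hAB.ge
    · exact (eq_of_subset_of_card_le h hAB.le).symm

variable [DecidableEq α]

/-- Flipping the rows with at most one 0 leaves at most one 1 in every row, so the flipped link is a
disjoint family. -/
theorem card_link_le_of_not_has_Q3 [Fintype α] {𝒜 : Finset (Finset α)} (h3 : ¬ Has Q3 𝒜) (r : α) :
    #(link r 𝒜) ≤ Fintype.card α + 1 := by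
  set L := link r 𝒜 with hL
  set M : Finset α := {s | #{A ∈ L | s ∉ A} ≤ 1} with hM
  have hinj : #(L.image (symmDiff M)) = #L :=
    card_image_of_injective _ (symmDiff_right_injective M)
  rw [← hinj]
  refine card_le_of_disjoint ?_
  simp only [mem_image]
  rintro _ ⟨A, hA, rfl⟩ _ ⟨B, hB, rfl⟩ x xA xB
  congr 1
  rw [mem_symmDiff] at xA xB
  by_cases hx : x ∈ M
  · have h := (mem_filter.1 hx).2
    exact card_le_one.1 h A (mem_filter.2 ⟨hA, by tauto⟩) B (mem_filter.2 ⟨hB, by tauto⟩)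
  · have xA' : x ∈ A := by tauto
    have xB' : x ∈ B := by tauto
    have hxr : r ≠ x := fun h => (mem_link.1 hA).2.2 (h ▸ xA')
    rcases link_card_le_one_or_of_not_has_Q3 h3 r x hxr with h | h
    · exact absurd (hM ▸ mem_filter.2 ⟨mem_univ x, h⟩) hx
    · exact card_le_one.1 h A (mem_filter.2 ⟨hA, xA'⟩) B (mem_filter.2 ⟨hB, xB'⟩)

theorem hitsRows_Q3 : HitsRows Q3.entry := by decide
theorem hitsRows_Q2 : HitsRows Q2.entry := by decide
theorem hitsRows_Q6 : HitsRows Q6.entry := by decide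
theorem hitsRows_Q7 : HitsRows Q7.entry := by decide
theorem hitsRows_Q8 : HitsRows Q8.entry := by decide
theorem hitsRows_Q9 : HitsRows Q9.entry := by decide

theorem card_le_of_not_has_Q3 [Fintype α] {𝒜 : Finset (Finset α)} (h3 : ¬ Has Q3 𝒜) :
    #𝒜 ≤ (Fintype.card α + 1) * Fintype.card α + 1 :=
  card_le_of_link (P := fun 𝒜 => ¬ Has Q3 𝒜) (fun _ _ h h' => h (h'.of_image_erase hitsRows_Q3))
    (fun _ _ hU _ h => ⟨hU.choose, hU.choose_spec, card_link_le_of_not_has_Q3 h _⟩)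
    univ 𝒜 (by simp) h3

/-- An element added in the middle step of a chain of four splits it two against two. -/
theorem not_strictMono_link_of_not_has_Q3 {𝒜 : Finset (Finset α)} (h3 : ¬ Has Q3 𝒜) {r : α}
    {g : Fin 4 → Finset α} (hg : StrictMono g) : ¬ ∀ i, g i ∈ link r 𝒜 := by
  intro hmem
  have h01 : g 0 ⊂ g 1 := hg (by decide)
  have h12 : g 1 ⊂ g 2 := hg (by decide)
  have h23 : g 2 ⊂ g 3 := hg (by decide)
  obtain ⟨s, hs2, hs1⟩ := exists_of_ssubset h12
  have hrs : r ≠ s := fun h => (mem_link.1 (hmem 2)).2.2 (h ▸ hs2)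
  rcases link_card_le_one_or_of_not_has_Q3 h3 r s hrs with h | h
  · exact h01.ne (card_le_one.1 h _ (mem_filter.2 ⟨hmem 0, fun h => hs1 (h01.subset h)⟩) _
      (mem_filter.2 ⟨hmem 1, hs1⟩))
  · exact h23.ne (card_le_one.1 h _ (mem_filter.2 ⟨hmem 2, hs2⟩) _
      (mem_filter.2 ⟨hmem 3, h23.subset hs2⟩))

/-- For incomparable `A`, `B`, the columns `A`, `B`, `insert r A`, `insert r B` form `Q8` on `r` and
one point from each difference. -/
theorem subset_or_subset_of_not_has_Q8 {𝒜 : Finset (Finset α)} (h8 : ¬ Has Q8 𝒜) {r : α}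
    {A B : Finset α} (hA : A ∈ link r 𝒜) (hB : B ∈ link r 𝒜) : A ⊆ B ∨ B ⊆ A := by
  by_contra! hcon
  obtain ⟨x, xA, xB⟩ := not_subset.1 hcon.1
  obtain ⟨y, yB, yA⟩ := not_subset.1 hcon.2
  rw [mem_link] at hA hB
  have hxr : x ≠ r := fun h => hA.2.2 (h ▸ xA)
  have hyr : y ≠ r := fun h => hB.2.2 (h ▸ yB)
  exact h8 (has_Q8 (x := x) (y := y) (z := r) hA.1 hB.1 hA.2.1 hB.2.1 xA yA hA.2.2 xB yB hB.2.2
    (by simp [xA]) (by simp [yA, hyr]) (by simp) (by simp [xB, hxr]) (by simp [yB]) (by simp))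

theorem card_le_of_not_has_Q3_Q8 [Fintype α] {𝒜 : Finset (Finset α)} (h3 : ¬ Has Q3 𝒜)
    (h8 : ¬ Has Q8 𝒜) : #𝒜 ≤ 3 * Fintype.card α + 1 := by
  refine card_le_of_link (P := fun 𝒜 => ¬ Has Q3 𝒜 ∧ ¬ Has Q8 𝒜) (fun _ _ h =>
    ⟨fun h' => h.1 (h'.of_image_erase hitsRows_Q3),
      fun h' => h.2 (h'.of_image_erase hitsRows_Q8)⟩)
    (fun U ℬ ⟨r, hr⟩ _ h => ⟨r, hr, ?_⟩) univ 𝒜 (by simp) ⟨h3, h8⟩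
  by_contra! hcon
  obtain ⟨g, hg, hmem⟩ := exists_strictMono_of_chain (n := 4) (fun A hA B hB =>
    subset_or_subset_of_not_has_Q8 h.2 hA hB) hcon
  exact not_strictMono_link_of_not_has_Q3 h.1 hg hmem

/-- `B` is the only member of the link of `r` that does not contain `s`. -/
def PrivateZero (𝒜 : Finset (Finset α)) (r s : α) (B : Finset α) : Prop :=
  B ∈ link r 𝒜 ∧ s ∉ B ∧ ∀ C ∈ link r 𝒜, s ∉ C → C = B

/-- The link supplies every column of `Q3` on rows `r`, `s` except a second column with pattern
(1,0); `D` would be that one. -/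
theorem PrivateZero.eq_insert {𝒜 : Finset (Finset α)} (h3 : ¬ Has Q3 𝒜) {r s : α}
    {B D : Finset α} (hL : 2 < #(link r 𝒜)) (hrs : r ≠ s) (hB : PrivateZero 𝒜 r s B) (hD : D ∈ 𝒜)
    (rD : r ∈ D) (sD : s ∉ D) : D = insert r B := by
  by_contra hne
  have h1 : 1 < #((link r 𝒜).erase B) := by rw [card_erase_of_mem hB.1]; omega
  obtain ⟨C, hC, C', hC', hCC⟩ := one_lt_card.1 h1
  rw [mem_erase] at hC hC'
  have sC : s ∈ C := by by_contra h; exact hC.1 (hB.2.2 C hC.2 h)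
  have sC' : s ∈ C' := by by_contra h; exact hC'.1 (hB.2.2 C' hC'.2 h)
  have hBL := mem_link.1 hB.1
  have hCL := mem_link.1 hC.2
  have hCL' := mem_link.1 hC'.2
  exact h3 (has_Q3' (x := r) (y := s) hBL.1 hCL.1 hCL'.1 hD hBL.2.1 hCL.2.1 hCC hne
    hBL.2.2 hB.2.1 hCL.2.2 sC hCL'.2.2 sC' rD sD (by simp) (by simp [hB.2.1, hrs.symm]) (by simp)
    (by simp [sC]))

/-- This makes the claims of different rows disjoint: no `s` serves two rows with large links. -/
theorem PrivateZero.false_of_not_has_Q3_Q6 {𝒜 : Finset (Finset α)} (h3 : ¬ Has Q3 𝒜)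
    (h6 : ¬ Has Q6 𝒜) {r r' s : α} {B B' : Finset α} (hL : 2 < #(link r 𝒜))
    (hL' : 2 < #(link r' 𝒜)) (hrs : r ≠ s) (hrs' : r' ≠ s) (hrr : r ≠ r')
    (hB : PrivateZero 𝒜 r s B) (hB' : PrivateZero 𝒜 r' s B') : False := by
  have key : ∀ {r r' : α} {B B' : Finset α}, 2 < #(link r 𝒜) → r ≠ s → r' ≠ s → r ≠ r' →
      PrivateZero 𝒜 r s B → PrivateZero 𝒜 r' s B' → r ∉ B' := by
    intro r r' B B' hL hrs hrs' hrr hB hB' hr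
    have hBL' := mem_link.1 hB'.1
    have h1 := hB.eq_insert h3 hL hrs hBL'.1 hr hB'.2.1
    have h2 := hB.eq_insert h3 hL hrs hBL'.2.1 (mem_insert_of_mem hr)
      (by simp [hB'.2.1, hrs'.symm])
    apply hBL'.2.2
    rw [h1, ← h2]
    exact mem_insert_self _ _
  have hrB' := key hL hrs hrs' hrr hB hB'
  have hrB := key hL' hrs' hrs hrr.symm hB' hB
  have hBL := mem_link.1 hB.1
  have hBL' := mem_link.1 hB'.1
  -- Otherwise `insert r B`, `insert r' B'` and `E` form `Q6` on `r`, `r'`, `s`.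
  have hno : ∀ E ∈ 𝒜, r ∉ E → r' ∉ E → s ∉ E := fun E hE rE rE' sE =>
    h6 (has_Q6 (x := r) (y := r') (z := s) hBL.2.1 hBL'.2.1 hE (by simp)
      (by simp [hrB, hrr.symm]) (by simp [hB.2.1, hrs.symm]) (by simp [hrB', hrr]) (by simp)
      (by simp [hB'.2.1, hrs'.symm]) rE rE' sE)
  have hpriv : PrivateZero 𝒜 r r' B := by
    refine ⟨hB.1, hrB, fun C hC hrC => hB.2.2 C hC ?_⟩
    have hCL := mem_link.1 hC
    exact hno C hCL.1 hCL.2.2 hrC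
  have h1 : 1 < #((link r' 𝒜).erase B') := by rw [card_erase_of_mem hB'.1]; omega
  obtain ⟨C, hC, C', hC', hCC⟩ := one_lt_card.1 h1
  -- Such a `C` must contain `r`, or else `hno` would make it equal to `B'`; then `hpriv`, with `r'`
  -- as the private row, determines it. Two choices of `C` are available, a contradiction.
  have hall : ∀ C ∈ (link r' 𝒜).erase B', C = insert r B := by
    intro C hC
    rw [mem_erase] at hC
    have hCL := mem_link.1 hC.2
    refine hpriv.eq_insert h3 hL hrr hCL.1 ?_ hCL.2.2
    by_contra hr
    exact hC.1 (hB'.2.2 C hC.2 (hno C hCL.1 hr hCL.2.2))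
  exact hCC ((hall C hC).trans (hall C' hC').symm)

/-- Two link members with private ones, together with `insert r C` for a third member `C`, give
`Q6`, so `O` has at most one element. Two members with neither a private one nor a private zero
contain each other. Hence at least two of the four members have private zeros, in distinct rows. -/
theorem two_le_card_privateZero {𝒜 : Finset (Finset α)} (h3 : ¬ Has Q3 𝒜) (h6 : ¬ Has Q6 𝒜)
    {U : Finset α} (hU : 𝒜 ⊆ U.powerset) {r : α} (hL : 4 ≤ #(link r 𝒜)) (S : Finset α)
    (hS : ∀ s ∈ U, s ≠ r → ∀ B, PrivateZero 𝒜 r s B → s ∈ S) : 2 ≤ #S := by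
  classical
  set L := link r 𝒜 with hLdef
  have hLU {A x} (hA : A ∈ L) (hx : x ∈ A) : x ∈ U ∧ x ≠ r :=
    ⟨mem_powerset.1 (hU (mem_link.1 hA).1) hx, fun h => (mem_link.1 hA).2.2 (h ▸ hx)⟩
  set O := {B ∈ L | ∃ t ∈ B, ∀ C ∈ L, t ∈ C → C = B} with hO
  set Z := {B ∈ L | ∃ s ∈ U, s ≠ r ∧ PrivateZero 𝒜 r s B} with hZ
  have hOcard : #O ≤ 1 := by
    refine card_le_one.2 fun A hA B hB => ?_
    simp only [hO, mem_filter] at hA hB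
    obtain ⟨hA, x, xA, hx⟩ := hA
    obtain ⟨hB, y, yB, hy⟩ := hB
    by_contra hAB
    have h1 : 0 < #((L.erase A).erase B) := by
      rw [card_erase_of_mem (mem_erase.2 ⟨Ne.symm hAB, hB⟩), card_erase_of_mem hA]
      omega
    obtain ⟨C, hC⟩ := card_pos.1 h1
    simp only [mem_erase] at hC
    have hCL := mem_link.1 hC.2.2
    have hAL := mem_link.1 hA
    have hBL := mem_link.1 hB
    have hxC : x ∉ C := fun h => hC.2.1 (hx C hC.2.2 h)
    have hyC : y ∉ C := fun h => hC.1 (hy C hC.2.2 h)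
    exact h6 (has_Q6 (x := x) (y := y) (z := r) hAL.1 hBL.1 hCL.2.1 xA
      (fun h => hAB (hy A hA h)) hAL.2.2 (fun h => hAB (hx B hB h).symm) yB hBL.2.2
      (by simp [hxC, (hLU hA xA).2]) (by simp [hyC, (hLU hB yB).2]) (by simp))
  have hrest : #((L \ O) \ Z) ≤ 1 := by
    refine card_le_one.2 fun A hA B hB => ?_
    have aux : ∀ A ∈ (L \ O) \ Z, ∀ B ∈ (L \ O) \ Z, A ⊆ B := by
      intro A hA B hB
      by_contra hAB
      obtain ⟨t, tA, tB⟩ := not_subset.1 hAB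
      simp only [Finset.mem_sdiff] at hA hB
      have ht := hLU hA.1.1 tA
      rcases link_card_le_one_or_of_not_has_Q3 h3 r t ht.2.symm with h | h
      · refine hB.2 (mem_filter.2 ⟨hB.1.1, t, ht.1, ht.2, hB.1.1, tB, fun C hC tC => ?_⟩)
        exact card_le_one.1 h C (mem_filter.2 ⟨hC, tC⟩) B (mem_filter.2 ⟨hB.1.1, tB⟩)
      · refine hA.1.2 (mem_filter.2 ⟨hA.1.1, t, tA, fun C hC tC => ?_⟩)
        exact card_le_one.1 h C (mem_filter.2 ⟨hC, tC⟩) A (mem_filter.2 ⟨hA.1.1, tA⟩)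
    exact (aux A hA B hB).antisymm (aux B hB A hA)
  have hZcard : 2 ≤ #Z := by
    have h1 := le_card_sdiff O L
    have h2 := le_card_sdiff Z (L \ O)
    omega
  refine hZcard.trans ?_
  have h1 : ∀ B ∈ Z, ∃ s ∈ S, PrivateZero 𝒜 r s B := by
    intro B hB
    obtain ⟨-, s, hsU, hsr, hB⟩ := mem_filter.1 hB
    exact ⟨s, hS s hsU hsr B hB, hB⟩
  choose φ hφS hφ using h1
  rw [← card_attach (s := Z)]
  refine card_le_card_of_injOn (fun B => φ B.1 B.2) (fun B _ => hφS B.1 B.2) fun A _ B _ hAB => ?_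
  have hAB' : φ A.1 A.2 = φ B.1 B.2 := hAB
  refine Subtype.ext ((hφ B.1 B.2).2.2 A.1 (hφ A.1 A.2).1 ?_)
  rw [← hAB']
  exact (hφ A.1 A.2).2.1

/-- If all links had at least 4 members, the rows would claim disjoint sets of at least two rows
each, which is impossible in `U`. -/
theorem card_le_of_not_has_Q3_Q6 [Fintype α] {𝒜 : Finset (Finset α)} (h3 : ¬ Has Q3 𝒜)
    (h6 : ¬ Has Q6 𝒜) : #𝒜 ≤ 3 * Fintype.card α + 1 := by
  classical
  refine card_le_of_link (P := fun 𝒜 => ¬ Has Q3 𝒜 ∧ ¬ Has Q6 𝒜) (fun _ _ h =>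
    ⟨fun h' => h.1 (h'.of_image_erase hitsRows_Q3),
      fun h' => h.2 (h'.of_image_erase hitsRows_Q6)⟩)
    (fun U ℬ hU hℬ h => ?_) univ 𝒜 (by simp) ⟨h3, h6⟩
  by_contra! hcon
  set S : α → Finset α := fun r => {s ∈ U | s ≠ r ∧ ∃ B, PrivateZero ℬ r s B} with hS
  have h1 : #U * 2 ≤ #(U.biUnion S) := by
    rw [card_biUnion (fun r hr r' hr' hrr => ?_), ← smul_eq_mul]
    refine card_nsmul_le_sum _ _ _ fun r hr => ?_
    rotate_left
    · refine disjoint_left.2 fun s hs hs' => ?_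
      obtain ⟨-, hsr, B, hB⟩ := mem_filter.1 hs
      obtain ⟨-, hsr', B', hB'⟩ := mem_filter.1 hs'
      have := hcon r hr
      have := hcon r' hr'
      exact PrivateZero.false_of_not_has_Q3_Q6 h.1 h.2 (by omega) (by omega) hsr.symm hsr'.symm
        hrr hB hB'
    · exact two_le_card_privateZero h.1 h.2 hℬ (hcon r hr) _ fun s hs hsr B hB =>
        mem_filter.2 ⟨hs, hsr, B, hB⟩
  have h2 := card_le_card (biUnion_subset.2 fun r (_ : r ∈ U) => filter_subset _ _ : U.biUnion S ⊆ U)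
  have := hU.card_pos
  omega

end UpperBounds

/-! ### `Q9` alone, and `Q3` with `Q9` -/

section UpperBounds

variable {α : Type*} [DecidableEq α]

/-- Compare `A` with `insert r B`: the row `r` is the second row of the lower half of `Q9`. -/
theorem card_sdiff_le_one_of_not_has_Q9 {𝒜 : Finset (Finset α)} (h9 : ¬ Has Q9 𝒜) {r : α}
    {A B : Finset α} (hA : A ∈ link r 𝒜) (hB : B ∈ link r 𝒜) (hBA : ¬ B ⊆ A) : #(A \ B) ≤ 1 := by
  by_contra! hcon
  obtain ⟨x, hx, y, hy, hxy⟩ := one_lt_card.1 hcon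
  obtain ⟨z, zB, zA⟩ := not_subset.1 hBA
  rw [Finset.mem_sdiff] at hx hy
  rw [mem_link] at hA hB
  have aux {u} (hu : u ∈ A) : u ≠ r := fun h => hA.2.2 (h ▸ hu)
  exact h9 (has_Q9 (z := z) (w := r) hA.1 hB.2.1 hxy (fun h => hB.2.2 (h ▸ zB)) hx.1 hy.1 zA
    hA.2.2 (by simp [hx.2, aux hx.1]) (by simp [hy.2, aux hy.1]) (by simp [zB]) (by simp))

/-- A weakening of the avoidance of `Q9` that makes families linear. -/
def SwapOrNested (𝒜 : Finset (Finset α)) : Prop :=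
  ∀ A ∈ 𝒜, ∀ B ∈ 𝒜, ¬ B ⊆ A → #(A \ B) ≤ 1

theorem SwapOrNested.image_erase {𝒜 : Finset (Finset α)} (h : SwapOrNested 𝒜) (r : α) :
    SwapOrNested (𝒜.image (·.erase r)) := by
  intro A hA B hB hBA
  obtain ⟨A, hA', rfl⟩ := mem_image.1 hA
  obtain ⟨B, hB', rfl⟩ := mem_image.1 hB
  refine (card_le_card ?_).trans (h A hA' B hB' fun hs => hBA (erase_subset_erase r hs))
  intro x
  simp only [Finset.mem_sdiff, mem_erase]
  tauto

/-- Adding `r` to one of two link members shows that they are nested and differ in at most one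
point; three distinct sizes cannot be pairwise consecutive. -/
theorem SwapOrNested.card_link_le {𝒜 : Finset (Finset α)} (h : SwapOrNested 𝒜) (r : α) :
    #(link r 𝒜) ≤ 2 := by
  have h1 : ∀ A ∈ link r 𝒜, ∀ B ∈ link r 𝒜, #(A \ B) ≤ 1 := by
    intro A hA B hB
    rw [mem_link] at hA hB
    refine (card_le_card ?_).trans
      (h A hA.1 _ hB.2.1 fun hs => hA.2.2 (hs (mem_insert_self r B)))
    intro x
    simp only [Finset.mem_sdiff, mem_insert]
    rintro ⟨xA, xB⟩
    exact ⟨xA, by rintro (rfl | hx); exacts [hA.2.2 xA, xB hx]⟩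
  have h2 : ∀ A ∈ link r 𝒜, ∀ B ∈ link r 𝒜, A ⊆ B ∨ B ⊆ A := by
    intro A hA B hB
    by_contra! hcon
    obtain ⟨x, xA, xB⟩ := not_subset.1 hcon.1
    obtain ⟨y, yB, yA⟩ := not_subset.1 hcon.2
    rw [mem_link] at hA hB
    have h3 := h _ hA.2.1 B hB.1 fun hs => by
      rcases mem_insert.1 (hs yB) with rfl | hy
      exacts [hB.2.2 yB, yA hy]
    have hxr : x = r := card_le_one.1 h3 x (by simp [xA, xB]) r (by simp [hB.2.2])
    exact hA.2.2 (hxr ▸ xA)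
  have h3 : ∀ A ∈ link r 𝒜, ∀ B ∈ link r 𝒜, A ≠ B → #A = #B + 1 ∨ #B = #A + 1 := by
    intro A hA B hB hAB
    have hAB1 := h1 A hA B hB
    have hBA1 := h1 B hB A hA
    rcases h2 A hA B hB with hs | hs
    · have := card_lt_card (hs.ssubset_of_ne hAB)
      rw [card_sdiff_of_subset hs] at hBA1
      omega
    · have := card_lt_card (hs.ssubset_of_ne hAB.symm)
      rw [card_sdiff_of_subset hs] at hAB1
      omega
  by_contra! hcon
  obtain ⟨A, B, C, hA, hB, hC, hAB, hAC, hBC⟩ := two_lt_card_iff.1 hcon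
  have := h3 A hA B hB hAB
  have := h3 A hA C hC hAC
  have := h3 B hB C hC hBC
  omega

/-- Link induction twice: links of a `Q9`-free family satisfy `SwapOrNested`, which bounds their own
links. -/
theorem card_le_of_not_has_Q9 [Fintype α] {𝒜 : Finset (Finset α)} (h9 : ¬ Has Q9 𝒜) :
    #𝒜 ≤ (2 * Fintype.card α + 1) * Fintype.card α + 1 := by
  refine card_le_of_link (P := fun 𝒜 => ¬ Has Q9 𝒜) (fun _ _ h h' =>
    h (h'.of_image_erase hitsRows_Q9)) (fun U ℬ ⟨r, hr⟩ _ h => ⟨r, hr, ?_⟩) univ 𝒜 (by simp) h9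
  refine card_le_of_link (P := SwapOrNested) (fun r _ h => h.image_erase r)
    (fun U ℬ ⟨r, hr⟩ _ h => ⟨r, hr, h.card_link_le r⟩) univ _ (by simp) fun A hA B hB hBA =>
    card_sdiff_le_one_of_not_has_Q9 h hA hB hBA

/-- The sets `D ∪ {x}` and `D ∪ {x, r}`, for `x ∈ R`, belong to `𝒜`. -/
def IsStar (𝒜 : Finset (Finset α)) (r : α) (D R : Finset α) : Prop :=
  r ∉ D ∧ ∀ x ∈ R, x ≠ r ∧ x ∉ D ∧ insert x D ∈ 𝒜 ∧ insert r (insert x D) ∈ 𝒜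

/-- The star supplies every column of `Q3` on `r`, `s` except a second one with pattern (0,1); `E`
would be that one. -/
theorem IsStar.eq_insert {𝒜 : Finset (Finset α)} (h3 : ¬ Has Q3 𝒜) {r s : α} {D R E : Finset α}
    (h : IsStar 𝒜 r D R) (hR : 2 < #R) (hs : s ∈ R) (hE : E ∈ 𝒜) (sE : s ∈ E) (rE : r ∉ E) :
    E = insert s D := by
  by_contra hne
  obtain ⟨y, hy, y', hy', hyy⟩ := one_lt_card.1
    (show 1 < #(R.erase s) by rw [card_erase_of_mem hs]; omega)
  rw [mem_erase] at hy hy'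
  obtain ⟨hsr, hsD, hs1, hs2⟩ := h.2 s hs
  obtain ⟨hyr, hyD, hy1, hy2⟩ := h.2 y hy.2
  obtain ⟨hyr', hyD', hy1', hy2'⟩ := h.2 y' hy'.2
  have hrD := h.1
  refine h3 (has_Q3' (x := r) (y := s) hy1 hE hs1 hy2 hy2' hs2 hne (fun heq => ?_) ?_ ?_ rE sE ?_
    ?_ ?_ ?_ ?_ ?_ ?_ ?_)
  · have : y ∈ insert r (insert y' D) := heq ▸ (by simp)
    simp [hyr, hyy, hyD] at this
  all_goals simp [*, hsr.symm, hyr.symm, hyr'.symm, hy.1.symm, hy'.1.symm]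

theorem IsStar.false_of_common {𝒜 : Finset (Finset α)} (h3 : ¬ Has Q3 𝒜) (h9 : ¬ Has Q9 𝒜)
    {r r' s : α} {D D' R R' : Finset α} (h : IsStar 𝒜 r D R) (h' : IsStar 𝒜 r' D' R')
    (hR : 2 < #R) (hR' : 2 < #R') (hrr : r ≠ r') (hs : s ∈ R) (hs' : s ∈ R') : False := by
  -- If `r ∉ D'`, both star members `D' ∪ {s}` and `D' ∪ {s, r'}` equal `D ∪ {s}`, although `r'`
  -- separates them.
  have key1 : ∀ {r r' : α} {D D' R R' : Finset α}, IsStar 𝒜 r D R → IsStar 𝒜 r' D' R' →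
      2 < #R → r ≠ r' → s ∈ R → s ∈ R' → r ∈ D' := by
    intro r r' D D' R R' h h' hR hrr hs hs'
    by_contra hr
    obtain ⟨hsr, hsD, hs1, hs2⟩ := h.2 s hs
    obtain ⟨hsr', hsD', hs1', hs2'⟩ := h'.2 s hs'
    have e1 := h.eq_insert h3 hR hs hs1' (by simp) (by simp [hr, hsr.symm])
    have e2 := h.eq_insert h3 hR hs hs2' (by simp) (by simp [hr, hsr.symm, hrr])
    have : r' ∈ insert s D' := by rw [e1, ← e2]; simp
    simp [hsr'.symm, h'.1] at this
  have hrD' := key1 h h' hR hrr hs hs'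
  have hrD := key1 h' h hR' hrr.symm hs' hs
  -- Otherwise `D ∪ {x}` and `D' ∪ {s}` form `Q9`, with `x`, `r'` against `s`, `r`.
  have key2 : ∀ {r r' : α} {D D' R R' : Finset α}, IsStar 𝒜 r D R → IsStar 𝒜 r' D' R' →
      s ∈ R → s ∈ R' → r ∈ D' → r' ∈ D → ∀ x ∈ R, x ≠ s → x ∈ D' := by
    intro r r' D D' R R' h h' hs hs' hrD' hrD x hx hxs
    by_contra hxD'
    obtain ⟨hsr, hsD, hs1, hs2⟩ := h.2 s hs
    obtain ⟨hsr', hsD', hs1', hs2'⟩ := h'.2 s hs'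
    obtain ⟨hxr, hxD, hx1, hx2⟩ := h.2 x hx
    refine h9 (has_Q9 (x := x) (y := r') (z := s) (w := r) hx1 hs1' (fun h => hxD (h ▸ hrD)) hsr
      (by simp) (by simp [hrD]) (by simp [hxs.symm, hsD]) (by simp [hxr.symm, h.1])
      (by simp [hxs, hxD']) (by simp [hsr'.symm, h'.1]) (by simp) (by simp [hrD']))
  obtain ⟨x, hx, hxs⟩ := exists_mem_ne (show 1 < #R by omega) s
  obtain ⟨y, hy, hys⟩ := exists_mem_ne (show 1 < #R' by omega) s
  have hyD := key2 h' h hs' hs hrD hrD' y hy hys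
  obtain ⟨hsr, hsD, hs1, hs2⟩ := h.2 s hs
  obtain ⟨hsr', hsD', hs1', hs2'⟩ := h'.2 s hs'
  obtain ⟨hxr, hxD, hx1, hx2⟩ := h.2 x hx
  obtain ⟨hyr', hyD', hy1', hy2'⟩ := h'.2 y hy
  exact h9 (has_Q9 (x := r') (y := y) (z := r) (w := s) hx1 hs1' hyr'.symm hsr.symm
    (by simp [hrD]) (by simp [hyD]) (by simp [hxr.symm, h.1]) (by simp [hxs.symm, hsD])
    (by simp [hsr'.symm, h'.1]) (by simp [hys, hyD']) (by simp [hrD']) (by simp))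

theorem card_le_of_forall_isStar {𝒜 : Finset (Finset α)} (h3 : ¬ Has Q3 𝒜) (h9 : ¬ Has Q9 𝒜)
    {U V : Finset α} (hV : ∀ r ∈ V, ∃ D R, IsStar 𝒜 r D R ∧ R ⊆ U ∧ 2 < #R) : #V * 3 ≤ #U := by
  choose! D R hDR hRU hR using hV
  have h1 : #V * 3 ≤ #(V.biUnion R) := by
    rw [card_biUnion (fun r hr r' hr' hrr => ?_), ← smul_eq_mul]
    · exact card_nsmul_le_sum _ _ _ fun r hr => hR r hr
    · exact disjoint_left.2 fun s hs hs' =>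
        (hDR r hr).false_of_common h3 h9 (hDR r' hr') (hR r hr) (hR r' hr') hrr hs hs'
  exact h1.trans (card_le_card (biUnion_subset.2 hRU))

/-- Three sets of equal size, pairwise differing by a swap, either have a common kernel one point
smaller or lie in a set one point larger; the second case is a star of complements. -/
theorem exists_isStar_or_isStar_compls [Fintype α] {𝒜 : Finset (Finset α)} (h3 : ¬ Has Q3 𝒜)
    (h9 : ¬ Has Q9 𝒜) {U : Finset α} (hU : 𝒜 ⊆ U.powerset) {r : α} (hr : 6 < #(link r 𝒜)) :
    (∃ D R, IsStar 𝒜 r D R ∧ R ⊆ U ∧ 2 < #R) ∨ ∃ D R, IsStar 𝒜ᶜˢ r D R ∧ R ⊆ U ∧ 2 < #R := by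
  -- Avoiding `Q9` nests link members of different sizes, so four sizes would give a chain forbidden
  -- by `Q3`. Seven members on three levels then put three on one level.
  have hlev : #((link r 𝒜).image card) ≤ 3 := by
    by_contra! hcon
    obtain ⟨g, hg, hmem⟩ := exists_strictMono_of_le_card_image (n := 4) (fun A hA B hB hAB => by
      by_contra hs
      have h1 := card_sdiff_le_one_of_not_has_Q9 h9 hB hA hs
      have h2 := card_sdiff_add_card_inter B A
      have h4 := card_sdiff_add_card_inter A B
      have h5 : 0 < #(A \ B) := card_pos.2 (sdiff_nonempty.2 hs)
      rw [inter_comm] at h4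
      omega) hcon
    exact not_strictMono_link_of_not_has_Q3 h3 hg hmem
  obtain ⟨k, -, hk⟩ := exists_lt_card_fiber_of_mul_lt_card_of_maps_to (n := 2)
    (fun A hA => mem_image_of_mem card hA) (show #((link r 𝒜).image card) * 2 < #(link r 𝒜) by omega)
  obtain ⟨A, B, C, hA, hB, hC, hAB, hAC, hBC⟩ := two_lt_card_iff.1 hk
  rw [mem_filter] at hA hB hC
  have swap {S T : Finset α} (hS : S ∈ link r 𝒜 ∧ #S = k) (hT : T ∈ link r 𝒜 ∧ #T = k)
      (hST : S ≠ T) : ∃ a ∈ S, a ∉ T ∧ S \ T = {a} := by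
    have h1 : ¬ S ⊆ T := fun h => hST (eq_of_subset_of_card_le h (by omega))
    have h2 : ¬ T ⊆ S := fun h => hST (eq_of_subset_of_card_le h (by omega)).symm
    have h4 := card_sdiff_le_one_of_not_has_Q9 h9 hS.1 hT.1 h2
    obtain ⟨a, haS, haT⟩ := not_subset.1 h1
    exact ⟨a, haS, haT, eq_singleton_iff_unique_mem.2 ⟨by simp [haS, haT], fun y hy =>
      card_le_one.1 h4 y hy a (by simp [haS, haT])⟩⟩
  obtain ⟨a, aA, aB, hAB'⟩ := swap hA hB hAB
  obtain ⟨b, bB, bA, hBA'⟩ := swap hB hA hAB.symm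
  obtain ⟨p, pA, pC, hAC'⟩ := swap hA hC hAC
  obtain ⟨c, cC, cA, hCA'⟩ := swap hC hA hAC.symm
  obtain ⟨q, qB, qC, hBC'⟩ := swap hB hC hBC
  obtain ⟨d, dC, dB, hCB'⟩ := swap hC hB hBC.symm
  have eAB (x) : x ∈ A ∧ x ∉ B ↔ x = a := by
    rw [← Finset.mem_sdiff, hAB', mem_singleton]
  have eBA (x) : x ∈ B ∧ x ∉ A ↔ x = b := by
    rw [← Finset.mem_sdiff, hBA', mem_singleton]
  have eAC (x) : x ∈ A ∧ x ∉ C ↔ x = p := by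
    rw [← Finset.mem_sdiff, hAC', mem_singleton]
  have eCA (x) : x ∈ C ∧ x ∉ A ↔ x = c := by
    rw [← Finset.mem_sdiff, hCA', mem_singleton]
  have eBC (x) : x ∈ B ∧ x ∉ C ↔ x = q := by
    rw [← Finset.mem_sdiff, hBC', mem_singleton]
  have eCB (x) : x ∈ C ∧ x ∉ B ↔ x = d := by
    rw [← Finset.mem_sdiff, hCB', mem_singleton]
  have hAU := mem_powerset.1 (hU (mem_link.1 hA.1).1)
  have hBU := mem_powerset.1 (hU (mem_link.1 hB.1).1)
  have hCU := mem_powerset.1 (hU (mem_link.1 hC.1).1)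
  have hAL := mem_link.1 hA.1
  have hBL := mem_link.1 hB.1
  have hCL := mem_link.1 hC.1
  have hne_r {x : α} {S : Finset α} (hS : r ∉ S) (hx : x ∈ S) : x ≠ r := fun h => hS (h ▸ hx)
  by_cases hpa : p = a
  · -- `A ∩ B ⊆ C`: a star
    subst hpa
    left
    have hbc : b ≠ c := by
      rintro rfl
      exact hBC (by ext x; specialize eBC x; specialize eCB x; specialize eAB x; grind)
    have hpb : p ≠ b := fun h => aB (h ▸ bB)
    have hpc : p ≠ c := fun h => pC (h ▸ cC)
    have iA : insert p (A ∩ B) = A := by ext x; specialize eAB x; grind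
    have iB : insert b (A ∩ B) = B := by ext x; specialize eBA x; grind
    have iC : insert c (A ∩ B) = C := by
      ext x; specialize eAB x; specialize eCA x; specialize eAC x; grind
    refine ⟨A ∩ B, {p, b, c}, ⟨by simp [hAL.2.2], ?_⟩, ?_, ?_⟩
    · simp only [mem_insert, mem_singleton, forall_eq_or_imp, forall_eq, iA, iB, iC, mem_inter]
      exact ⟨⟨hne_r hAL.2.2 pA, fun h => aB h.2, hAL.1, hAL.2.1⟩,
        ⟨hne_r hBL.2.2 bB, fun h => bA h.1, hBL.1, hBL.2.1⟩,
        ⟨hne_r hCL.2.2 cC, fun h => cA h.1, hCL.1, hCL.2.1⟩⟩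
    · simp [insert_subset_iff, hAU pA, hBU bB, hCU cC]
    · rw [card_eq_three.2 ⟨p, b, c, hpb, hpc, hbc, rfl⟩]
      norm_num
  · -- `C ⊆ A ∪ B`: a star in the complement
    right
    have pB : p ∈ B := by specialize eAB p; tauto
    have hpq : p = q := (eBC p).1 ⟨pB, pC⟩
    subst hpq
    have hbc : b = c := by
      refine (eCA b).1 ⟨?_, bA⟩
      by_contra hb
      have := (eBC b).1 ⟨bB, hb⟩
      exact bA (this ▸ pA)
    subst hbc
    have hab : a ≠ b := fun h => aB (h ▸ bB)
    have hap : a ≠ p := fun h => hpa h.symm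
    have hbp : b ≠ p := fun h => bA (h ▸ pA)
    set W := insert r (A ∪ B) with hW
    have iA : insert b Wᶜ = (insert r A)ᶜ := by
      ext x; specialize eBA x; have := hne_r hBL.2.2 bB; simp [W]; grind
    have iB : insert a Wᶜ = (insert r B)ᶜ := by
      ext x; specialize eAB x; have := hne_r hAL.2.2 aA; simp [W]; grind
    have iC : insert p Wᶜ = (insert r C)ᶜ := by
      ext x; specialize eAC x; specialize eCA x; specialize eBC x
      have := hne_r hAL.2.2 pA; simp [W]; grind
    have ins {S : Finset α} (hS : r ∉ S) : insert r (insert r S)ᶜ = Sᶜ := by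
      ext x; by_cases hx : x = r <;> simp [hx, hS]
    refine ⟨Wᶜ, {a, b, p}, ⟨by simp [W], ?_⟩, ?_, ?_⟩
    · simp only [mem_insert, mem_singleton, forall_eq_or_imp, forall_eq, iA, iB, iC,
        ins hAL.2.2, ins hBL.2.2, ins hCL.2.2, mem_compls, compl_compl]
      exact ⟨⟨hne_r hAL.2.2 aA, by simp [W, aA], hBL.2.1, hBL.1⟩,
        ⟨hne_r hBL.2.2 bB, by simp [W, bB], hAL.2.1, hAL.1⟩,
        ⟨hne_r hAL.2.2 pA, by simp [W, pA], hCL.2.1, hCL.1⟩⟩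
    · simp [insert_subset_iff, hAU aA, hBU bB, hAU pA]
    · rw [card_eq_three.2 ⟨a, b, p, hab, hap, hbp, rfl⟩]
      norm_num

/-- If all links were large, each row would be the centre of a star or of a complementary star, but
each kind accounts for at most a third of the rows. -/
theorem card_le_of_not_has_Q3_Q9 [Fintype α] {𝒜 : Finset (Finset α)} (h3 : ¬ Has Q3 𝒜)
    (h9 : ¬ Has Q9 𝒜) : #𝒜 ≤ 6 * Fintype.card α + 1 := by
  classical
  refine card_le_of_link (P := fun 𝒜 => ¬ Has Q3 𝒜 ∧ ¬ Has Q9 𝒜) (fun _ _ h =>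
    ⟨fun h' => h.1 (h'.of_image_erase hitsRows_Q3),
      fun h' => h.2 (h'.of_image_erase hitsRows_Q9)⟩)
    (fun U ℬ hU hℬ h => ?_) univ 𝒜 (by simp) ⟨h3, h9⟩
  by_contra! hcon
  set V := {r ∈ U | ∃ D R, IsStar ℬ r D R ∧ R ⊆ U ∧ 2 < #R} with hV
  set V' := {r ∈ U | ∃ D R, IsStar ℬᶜˢ r D R ∧ R ⊆ U ∧ 2 < #R} with hV'
  have h1 : #V * 3 ≤ #U := card_le_of_forall_isStar h.1 h.2 fun r hr => (mem_filter.1 hr).2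
  have h2 : #V' * 3 ≤ #U := card_le_of_forall_isStar (not_has_Q3_compls h.1)
    (not_has_Q9_compls h.2) fun r hr => (mem_filter.1 hr).2
  have h4 : U ⊆ V ∪ V' := by
    intro r hr
    rw [mem_union, mem_filter, mem_filter]
    exact (exists_isStar_or_isStar_compls h.1 h.2 hℬ (hcon r hr)).imp (⟨hr, ·⟩) (⟨hr, ·⟩)
  have h5 := (card_le_card h4).trans (card_union_le _ _)
  have := hU.card_pos
  omega

end UpperBounds

/-! ### `Q9` with `Q8`, or with `Q6` and `Q7`; remaining upper bounds -/

section UpperBounds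

variable {α : Type*}

/-- Avoidance hypotheses under which links are chains. -/
def ChainLike (𝒜 : Finset (Finset α)) : Prop :=
  ¬ Has Q9 𝒜 ∧ (¬ Has Q8 𝒜 ∨ ¬ Has Q6 𝒜 ∧ ¬ Has Q7 𝒜)

/-- `A`, `B`, `C`, `D` form `Q8` and `A`, `B`, `E` form `Q6`, so both alternatives fail at once. -/
theorem ChainLike.false_of_mem {𝒜 : Finset (Finset α)} (h : ChainLike 𝒜) {x y z : α}
    {A B C D E : Finset α} (hA : A ∈ 𝒜) (hB : B ∈ 𝒜) (hC : C ∈ 𝒜) (hD : D ∈ 𝒜) (hE : E ∈ 𝒜)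
    (xA : x ∈ A) (yA : y ∉ A) (zA : z ∉ A) (xB : x ∉ B) (yB : y ∈ B) (zB : z ∉ B)
    (xC : x ∈ C) (yC : y ∉ C) (zC : z ∈ C) (xD : x ∉ D) (yD : y ∈ D) (zD : z ∈ D)
    (xE : x ∉ E) (yE : y ∉ E) (zE : z ∈ E) : False := by
  rcases h.2 with h | h
  · exact h (has_Q8 hA hB hC hD xA yA zA xB yB zB xC yC zC xD yD zD)
  · exact h.1 (has_Q6 hA hB hE xA yA zA xB yB zB xE yE zE)

variable [DecidableEq α]

theorem ChainLike.compls [Fintype α] {𝒜 : Finset (Finset α)} (h : ChainLike 𝒜) :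
    ChainLike 𝒜ᶜˢ :=
  ⟨not_has_Q9_compls h.1, h.2.imp not_has_Q8_compls fun h =>
    ⟨not_has_Q6_compls h.2, not_has_Q7_compls h.1⟩⟩

theorem ChainLike.image_erase {𝒜 : Finset (Finset α)} (h : ChainLike 𝒜) (r : α) :
    ChainLike (𝒜.image (·.erase r)) :=
  ⟨fun h' => h.1 (h'.of_image_erase hitsRows_Q9),
    h.2.imp (fun h h' => h (h'.of_image_erase hitsRows_Q8)) fun h =>
      ⟨fun h' => h.1 (h'.of_image_erase hitsRows_Q6),
        fun h' => h.2 (h'.of_image_erase hitsRows_Q7)⟩⟩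

/-- In the second alternative let `A`, `B` be incomparable with witnesses `a`, `b`. A link member
with both witnesses gives `Q7`, one with neither gives `Q6`, and one with exactly one is `A` or `B`
by `Q9`; so the link has only two members. -/
theorem ChainLike.subset_or_subset_of_mem_link {𝒜 : Finset (Finset α)} (h : ChainLike 𝒜) {r : α}
    (hr : 2 < #(link r 𝒜)) : ∀ A ∈ link r 𝒜, ∀ B ∈ link r 𝒜, A ⊆ B ∨ B ⊆ A := by
  intro A hA B hB
  rcases h.2 with h8 | ⟨h6, h7⟩
  · exact subset_or_subset_of_not_has_Q8 h8 hA hB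
  by_contra! hcon
  have aux : ∀ {A B C : Finset α} {a b : α}, A ∈ link r 𝒜 → B ∈ link r 𝒜 → C ∈ link r 𝒜 →
      a ∈ A → a ∉ B → b ∈ B → b ∉ A → a ∈ C → b ∉ C → C = A := by
    intro A B C a b hA hB hC aA aB bB bA aC bC
    have single {S T : Finset α} {s t : α} (hS : S ∈ link r 𝒜) (hT : T ∈ link r 𝒜)
        (sS : s ∈ S) (sT : s ∉ T) (tT : t ∈ T) (tS : t ∉ S) (x : α) : x ∈ S ∧ x ∉ T ↔ x = s := by
      have h1 := card_sdiff_le_one_of_not_has_Q9 h.1 hS hT fun hs => tS (hs tT)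
      refine ⟨fun hx => card_le_one.1 h1 x (Finset.mem_sdiff.2 hx) s
        (Finset.mem_sdiff.2 ⟨sS, sT⟩), ?_⟩
      rintro rfl
      exact ⟨sS, sT⟩
    ext x
    have e1 := single hA hB aA aB bB bA x
    have e2 := single hB hA bB bA aA aB x
    have e3 := single hC hB aC aB bB bC x
    have e4 := single hB hC bB bC aC aB x
    tauto
  obtain ⟨a, aA, aB⟩ := not_subset.1 hcon.1
  obtain ⟨b, bB, bA⟩ := not_subset.1 hcon.2
  have hsub : link r 𝒜 ⊆ {A, B} := by
    intro C hC
    rw [mem_insert, mem_singleton]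
    have hAL := mem_link.1 hA
    have hBL := mem_link.1 hB
    have hCL := mem_link.1 hC
    have har : a ≠ r := fun h => hAL.2.2 (h ▸ aA)
    have hbr : b ≠ r := fun h => hBL.2.2 (h ▸ bB)
    by_cases aC : a ∈ C <;> by_cases bC : b ∈ C
    · exact absurd (has_Q7 (x := a) (y := b) (z := r) hBL.2.1 hAL.2.1 hCL.1 (by simp [har, aB])
        (by simp [bB]) (by simp) (by simp [aA]) (by simp [hbr, bA]) (by simp) aC bC hCL.2.2) h7
    · exact .inl (aux hA hB hC aA aB bB bA aC bC)
    · exact .inr (aux hB hA hC bB bA aA aB bC aC)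
    · exact absurd (has_Q6 (x := a) (y := b) (z := r) hAL.1 hBL.1 hCL.2.1 aA bA hAL.2.2 aB bB
        hBL.2.2 (by simp [har, aC]) (by simp [hbr, bC]) (by simp)) h6
  have := (card_le_card hsub).trans card_le_two
  omega

/-- Avoiding `Q9` makes members of the two links comparable when each misses the row of the other,
and `false_of_mem` makes `Y \ X` and `Y' \ X'` disjoint. This leaves only `Y ⊆ X'` or `Y' ⊆ X`. -/
theorem ChainLike.card_ne_of_notMem {𝒜 : Finset (Finset α)} (h : ChainLike 𝒜) {r r' : α}
    (hrr : r ≠ r') {X Y X' Y' : Finset α} (hX : X ∈ link r 𝒜) (hY : Y ∈ link r 𝒜)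
    (hX' : X' ∈ link r' 𝒜) (hY' : Y' ∈ link r' 𝒜) (hXY : X ⊂ Y) (hXY' : X' ⊂ Y')
    (hr' : r' ∉ Y) (hr : r ∉ Y') : #Y ≠ #Y' := by
  have comp : ∀ {A A' : Finset α}, A ∈ link r 𝒜 → A' ∈ link r' 𝒜 → r' ∉ A → r ∉ A' →
      A ⊆ A' ∨ A' ⊆ A := by
    intro A A' hA hA' hr' hr
    by_contra! hcon
    obtain ⟨x, xA, xA'⟩ := not_subset.1 hcon.1
    obtain ⟨y, yA', yA⟩ := not_subset.1 hcon.2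
    rw [mem_link] at hA hA'
    have hxr : x ≠ r := fun h => hA.2.2 (h ▸ xA)
    have hxr' : x ≠ r' := fun h => hr' (h ▸ xA)
    have hyr : y ≠ r := fun h => hr (h ▸ yA')
    have hyr' : y ≠ r' := fun h => hA'.2.2 (h ▸ yA')
    exact h.1 (has_Q9 (x := x) (y := r) (z := y) (w := r') hA.2.1 hA'.2.1 hxr hyr'
      (by simp [xA]) (by simp) (by simp [hyr, yA]) (by simp [hrr.symm, hr'])
      (by simp [hxr', xA']) (by simp [hrr, hr]) (by simp [yA']) (by simp))
  have key : ∀ s, s ∈ Y → s ∉ X → s ∈ Y' → s ∉ X' → False := by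
    intro s sY sX sY' sX'
    have hXL := mem_link.1 hX
    have hYL := mem_link.1 hY
    have hXL' := mem_link.1 hX'
    have hYL' := mem_link.1 hY'
    have hsr : s ≠ r := fun h => hYL.2.2 (h ▸ sY)
    have hsr' : s ≠ r' := fun h => hr' (h ▸ sY)
    have hr'X : r' ∉ X := fun h => hr' (hXY.subset h)
    have hrX' : r ∉ X' := fun h => hr (hXY'.subset h)
    exact h.false_of_mem (x := r) (y := r') (z := s) hXL.2.1 hXL'.2.1 hYL.2.1 hYL'.2.1 hYL.1
      (by simp) (by simp [hrr.symm, hr'X]) (by simp [hsr, sX]) (by simp [hrr, hrX']) (by simp)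
      (by simp [hsr', sX']) (by simp) (by simp [hrr.symm, hr']) (by simp [sY])
      (by simp [hrr, hr]) (by simp) (by simp [sY']) hYL.2.2 hr' sY
  have hr'X : r' ∉ X := fun h => hr' (hXY.subset h)
  have hrX' : r ∉ X' := fun h => hr (hXY'.subset h)
  obtain ⟨a, aY, aX⟩ := exists_of_ssubset hXY
  obtain ⟨b, bY', bX'⟩ := exists_of_ssubset hXY'
  by_cases hYX' : Y ⊆ X'
  · exact ((card_le_card hYX').trans_lt (card_lt_card hXY')).ne
  by_cases hYX : Y' ⊆ X
  · exact ((card_le_card hYX).trans_lt (card_lt_card hXY)).ne'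
  exfalso
  obtain ⟨s, sY, sX'⟩ := not_subset.1 hYX'
  obtain ⟨t, tY', tX⟩ := not_subset.1 hYX
  rcases comp hX hX' hr'X hrX' with h3 | h3 <;> rcases comp hY hY' hr' hr with h4 | h4
  · exact key s sY (fun h => sX' (h3 h)) (h4 sY) sX'
  · exact key b (h4 bY') (fun h => bX' (h3 h)) bY' bX'
  · exact key a aY aX (h4 aY) (fun h => aX (h3 h))
  · exact key t (h4 tY') tX tY' (fun h => tX (h3 h))

/-- Avoiding `Q9` bounds `Y \ Y'` by one point. If `Y` were at least as large as `Y'`, then `Y' \ Y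
= {r}` and `Y \ Y' = {u}`, which forces `r' ∈ Z` and `r ∉ X'` and yields the forbidden pattern on
`r`, `r'`, `u`. -/
theorem ChainLike.card_lt_of_mem_of_notMem {𝒜 : Finset (Finset α)} (h : ChainLike 𝒜) {r r' : α}
    {Y Z X' Y' : Finset α} (hY : Y ∈ link r 𝒜) (hZ : Z ∈ link r 𝒜)
    (hX' : X' ∈ link r' 𝒜) (hY' : Y' ∈ link r' 𝒜) (hYZ : Y ⊂ Z) (hXY' : X' ⊂ Y')
    (hr' : r' ∉ Y) (hr : r ∈ Y') : #Y < #Y' := by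
  have hYL := mem_link.1 hY
  have hZL := mem_link.1 hZ
  have hXL' := mem_link.1 hX'
  have hYL' := mem_link.1 hY'
  have hrr : r ≠ r' := fun h => hYL'.2.2 (h ▸ hr)
  have diff : ∀ {A A' : Finset α}, A ∈ link r 𝒜 → A' ∈ link r' 𝒜 → r' ∉ A → r ∈ A' →
      ∀ x, x ∈ A → x ∉ A' → ∀ y, y ∈ A → y ∉ A' → x = y := by
    intro A A' hA hA' hr' hr x xA xA' y yA yA'
    by_contra hxy
    rw [mem_link] at hA hA'
    have aux {u : α} (hu : u ∈ A) : u ≠ r' := fun h => hr' (h ▸ hu)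
    exact h.1 (has_Q9 (x := x) (y := y) (z := r) (w := r') hA.1 hA'.2.1 hxy hrr xA yA hA.2.2 hr'
      (by simp [aux xA, xA']) (by simp [aux yA, yA']) (by simp [hr]) (by simp))
  by_contra! hle
  have h1 : #(Y \ Y') ≤ 1 := by
    refine card_le_one.2 fun x hx y hy => ?_
    rw [Finset.mem_sdiff] at hx hy
    exact diff hY hY' hr' hr x hx.1 hx.2 y hy.1 hy.2
  have h2 := card_sdiff_add_card_inter Y Y'
  have h3 := card_sdiff_add_card_inter Y' Y
  rw [inter_comm] at h3
  have hrY' : r ∈ Y' \ Y := Finset.mem_sdiff.2 ⟨hr, hYL.2.2⟩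
  have h4 : #(Y' \ Y) ≤ 1 := by omega
  have h5 : 0 < #(Y' \ Y) := card_pos.2 ⟨r, hrY'⟩
  obtain ⟨u, hu⟩ := card_pos.1 (show 0 < #(Y \ Y') by omega)
  have only_r : ∀ x, x ∈ Y' → x ∉ Y → x = r := fun x hx hx' =>
    card_le_one.1 h4 x (Finset.mem_sdiff.2 ⟨hx, hx'⟩) r hrY'
  rw [Finset.mem_sdiff] at hu
  have hr'Z : r' ∈ Z := by
    by_contra hcon
    obtain ⟨z, zZ, zY⟩ := exists_of_ssubset hYZ
    have zY' : z ∉ Y' := fun hz => hZL.2.2 (only_r z hz zY ▸ zZ)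
    have := diff hZ hY' hcon hr z zZ zY' u (hYZ.subset hu.1) hu.2
    exact zY (this ▸ hu.1)
  have hrX' : r ∉ X' := by
    intro hcon
    obtain ⟨w, wY', wX'⟩ := exists_of_ssubset hXY'
    have wY : w ∈ Y := by
      by_contra hw
      exact wX' (only_r w wY' hw ▸ hcon)
    have := diff hY hX' hr' hcon w wY wX' u hu.1 (fun h => hu.2 (hXY'.subset h))
    exact hu.2 (this ▸ wY')
  have hur : u ≠ r := fun h => hYL.2.2 (h ▸ hu.1)
  have hur' : u ≠ r' := fun h => hr' (h ▸ hu.1)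
  have huX' : u ∉ X' := fun h => hu.2 (hXY'.subset h)
  exact h.false_of_mem (x := r) (y := r') (z := u) hYL'.1 hXL'.2.1 hYL.2.1 hZL.1 hYL.1
    hr hYL'.2.2 hu.2 (by simp [hrr, hrX']) (by simp) (by simp [hur', huX']) (by simp)
    (by simp [hrr.symm, hr']) (by simp [hu.1]) hZL.2.2 hr'Z (hYZ.subset hu.1) hYL.2.2 hr' hu.1

theorem insert_compl_mem_link_compls [Fintype α] {𝒜 : Finset (Finset α)} {r : α} {A : Finset α}
    (hA : A ∈ link r 𝒜) : (insert r A)ᶜ ∈ link r 𝒜ᶜˢ := by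
  rw [mem_link] at hA ⊢
  have h1 : insert r (insert r A)ᶜ = Aᶜ := by
    ext x; by_cases hx : x = r <;> simp [hx, hA.2.2]
  rw [h1, mem_compls, mem_compls, compl_compl, compl_compl]
  exact ⟨hA.2.1, hA.1, by simp⟩

/-- Complementing within the link, `A ↦ (insert r A)ᶜ`, reverses inclusions and reduces to
`card_ne_of_notMem`. -/
theorem ChainLike.card_ne_of_mem [Fintype α] {𝒜 : Finset (Finset α)} (h : ChainLike 𝒜) {r r' : α}
    (hrr : r ≠ r') {Y Z Y' Z' : Finset α} (hY : Y ∈ link r 𝒜) (hZ : Z ∈ link r 𝒜)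
    (hY' : Y' ∈ link r' 𝒜) (hZ' : Z' ∈ link r' 𝒜) (hYZ : Y ⊂ Z) (hYZ' : Y' ⊂ Z')
    (hr' : r' ∈ Y) (hr : r ∈ Y') : #Y ≠ #Y' := by
  have anti : ∀ {r : α} {Y Z : Finset α}, Y ∈ link r 𝒜 → Z ∈ link r 𝒜 → Y ⊂ Z →
      (insert r Z)ᶜ ⊂ (insert r Y)ᶜ := by
    intro r Y Z hY hZ hYZ
    rw [mem_link] at hY hZ
    obtain ⟨z, zZ, zY⟩ := exists_of_ssubset hYZ
    have hzr : z ≠ r := fun h => hZ.2.2 (h ▸ zZ)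
    refine _root_.ssubset_iff_subset_ne.2 ⟨compl_subset_compl.2 (insert_subset_insert r hYZ.subset), ?_⟩
    intro heq
    have : z ∈ (insert r Y)ᶜ := by simp [hzr, zY]
    rw [← heq] at this
    simp [zZ] at this
  have h1 := h.compls.card_ne_of_notMem hrr (insert_compl_mem_link_compls hZ)
    (insert_compl_mem_link_compls hY) (insert_compl_mem_link_compls hZ')
    (insert_compl_mem_link_compls hY') (anti hY hZ hYZ) (anti hY' hZ' hYZ') (by simp [hr'])
    (by simp [hr])
  rw [card_compl, card_compl, card_insert_of_notMem (mem_link.1 hY).2.2,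
    card_insert_of_notMem (mem_link.1 hY').2.2] at h1
  intro heq
  rw [heq] at h1
  exact h1 rfl

/-- If every link contains a chain `X ⊂ Y ⊂ Z`, the sizes of the middle members are pairwise
distinct, yet lie between 1 and `#U - 1`. -/
theorem ChainLike.card_le [Fintype α] {𝒜 : Finset (Finset α)} (h : ChainLike 𝒜) :
    #𝒜 ≤ 2 * Fintype.card α + 1 := by
  refine card_le_of_link (P := ChainLike) (fun r _ h => h.image_erase r)
    (fun U ℬ hU hℬ h => ?_) univ 𝒜 (by simp) h
  by_contra! hcon
  have h1 : ∀ r ∈ U, ∃ X Y Z, X ∈ link r ℬ ∧ Y ∈ link r ℬ ∧ Z ∈ link r ℬ ∧ X ⊂ Y ∧ Y ⊂ Z := by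
    intro r hr
    obtain ⟨g, hg, hmem⟩ := exists_strictMono_of_chain (n := 3)
      (h.subset_or_subset_of_mem_link (hcon r hr)) (hcon r hr)
    exact ⟨g 0, g 1, g 2, hmem 0, hmem 1, hmem 2, hg (by decide), hg (by decide)⟩
  choose! X Y Z hX hY hZ hXY hYZ using h1
  have hmaps : ∀ r ∈ U, #(Y r) ∈ Ico 1 #U := by
    intro r hr
    have h2 := card_lt_card (hXY r hr)
    have h3 := card_lt_card (hYZ r hr)
    have h4 := card_le_card (mem_powerset.1 (hℬ (mem_link.1 (hZ r hr)).1))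
    rw [mem_Ico]
    omega
  have hinj : Set.InjOn (fun r => #(Y r)) U := by
    intro r hr r' hr' heq
    by_contra hrr
    have heq' : #(Y r) = #(Y r') := heq
    by_cases h2 : r' ∈ Y r <;> by_cases h3 : r ∈ Y r'
    · exact h.card_ne_of_mem hrr (hY r hr) (hZ r hr) (hY r' hr') (hZ r' hr') (hYZ r hr)
        (hYZ r' hr') h2 h3 heq'
    · exact (h.card_lt_of_mem_of_notMem (hY r' hr') (hZ r' hr') (hX r hr) (hY r hr) (hYZ r' hr')
        (hXY r hr) h3 h2).ne heq'.symm
    · exact (h.card_lt_of_mem_of_notMem (hY r hr) (hZ r hr) (hX r' hr') (hY r' hr') (hYZ r hr)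
        (hXY r' hr') h2 h3).ne heq'
    · exact h.card_ne_of_notMem hrr (hX r hr) (hY r hr) (hX r' hr') (hY r' hr') (hXY r hr)
        (hXY r' hr') h2 h3 heq'
  have h2 := card_le_card_of_injOn _ hmaps hinj
  rw [Nat.card_Ico] at h2
  have := hU.card_pos
  omega

/-- A link member with two points would form `Q2` with its extension by `r`; hence links consist of
sets with at most one point. -/
theorem card_le_of_not_has_Q2 [Fintype α] {𝒜 : Finset (Finset α)} (h2 : ¬ Has Q2 𝒜) :
    #𝒜 ≤ (Fintype.card α + 1) * Fintype.card α + 1 := by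
  refine card_le_of_link (P := fun 𝒜 => ¬ Has Q2 𝒜) (fun _ _ h h' =>
    h (h'.of_image_erase hitsRows_Q2)) (fun U ℬ ⟨r, hr⟩ _ h => ⟨r, hr, ?_⟩) univ 𝒜 (by simp) h2
  refine card_le_of_disjoint fun A hA B hB x xA xB => ?_
  have aux : ∀ A ∈ link r ℬ, x ∈ A → A = {x} := by
    intro A hA xA
    rw [mem_link] at hA
    refine eq_singleton_iff_unique_mem.2 ⟨xA, fun y yA => ?_⟩
    by_contra hyx
    have := eq_of_not_has_Q2 h hA.1 hA.2.1 yA xA (mem_insert_of_mem yA) (mem_insert_of_mem xA) hyx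
    exact hA.2.2 (this ▸ mem_insert_self r A)
  rw [aux A hA xA, aux B hB xB]

theorem not_has_Q2_of_not_has_Q5 {𝒜 : Finset (Finset α)} (h5 : ¬ Has Q5 𝒜) : ¬ Has Q2 𝒜 := by
  rintro ⟨f, g, hf, hg, hmem, he⟩
  change Function.Injective (f : Fin 2 → α) at hf
  change Function.Injective (g : Fin 2 → Finset α) at hg
  have hall : ∀ (i : Fin 2) (c : Fin 2), f i ∈ g c := by
    intro i c
    refine (he i c).2 ?_
    change (!![1, 1; 1, 1] : Matrix (Fin 2) (Fin 2) (Fin 2)) i c = 1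
    fin_cases i <;> fin_cases c <;> rfl
  have hfne : f (0 : Fin 2) ≠ f (1 : Fin 2) := hf.ne (show (0 : Fin 2) ≠ 1 by decide)
  have hgne : g (0 : Fin 2) ≠ g (1 : Fin 2) := hg.ne (show (0 : Fin 2) ≠ 1 by decide)
  have key : ∀ A ∈ 𝒜, f (0 : Fin 2) ∈ A → f (1 : Fin 2) ∈ A →
      A = {f (0 : Fin 2), f (1 : Fin 2)} := by
    intro A hA h0 h1
    ext z
    rw [mem_insert, mem_singleton]
    refine ⟨fun zA => ?_, by rintro (rfl | rfl) <;> assumption⟩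
    by_contra! hz
    refine h5 (show HasMat !![1; 1; 1] 𝒜 from ⟨![f (0 : Fin 2), f (1 : Fin 2), z], ![A],
      injective_vec3 hfne hz.1.symm hz.2.symm, Function.injective_of_subsingleton _, ?_, ?_⟩)
    · intro c; fin_cases c; exact hA
    · intro i c; fin_cases c; fin_cases i <;> simp [*]
  exact hgne ((key _ (hmem _) (hall 0 0) (hall 1 0)).trans
    (key _ (hmem _) (hall 0 1) (hall 1 1)).symm)

theorem not_has_Q1_of_not_has_Q4 [Fintype α] {𝒜 : Finset (Finset α)} (h4 : ¬ Has Q4 𝒜) :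
    ¬ Has Q1 𝒜 := by
  have h := not_has_Q1_compls (not_has_Q2_of_not_has_Q5 (not_has_Q5_compls h4))
  rwa [compls_compls] at h

/-- Among three columns two agree in each row, but each of the three pairs agrees in at most one 1
and one 0, which covers at most six rows. -/
theorem card_le_two_of_not_has_Q1_Q2 [Fintype α] {𝒜 : Finset (Finset α)} (h1 : ¬ Has Q1 𝒜)
    (h2 : ¬ Has Q2 𝒜) (hα : 6 < Fintype.card α) : #𝒜 ≤ 2 := by
  by_contra! hcon
  obtain ⟨A, B, C, hA, hB, hC, hAB, hAC, hBC⟩ := two_lt_card_iff.1 hcon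
  have inter {𝒜 : Finset (Finset α)} (h2 : ¬ Has Q2 𝒜) {S T : Finset α} (hS : S ∈ 𝒜) (hT : T ∈ 𝒜)
      (hST : S ≠ T) : #(S ∩ T) ≤ 1 := by
    refine card_le_one.2 fun x hx y hy => ?_
    rw [mem_inter] at hx hy
    by_contra hxy
    exact hST (eq_of_not_has_Q2 h2 hS hT hx.1 hy.1 hx.2 hy.2 hxy)
  have interc {S T : Finset α} (hS : S ∈ 𝒜) (hT : T ∈ 𝒜) (hST : S ≠ T) : #(Sᶜ ∩ Tᶜ) ≤ 1 :=
    inter (not_has_Q2_compls h1) (mem_compls.2 (by simpa)) (mem_compls.2 (by simpa))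
      (fun h => hST (compl_injective h))
  have hcover : (univ : Finset α) ⊆ ((A ∩ B) ∪ (A ∩ C) ∪ (B ∩ C)) ∪
      ((Aᶜ ∩ Bᶜ) ∪ (Aᶜ ∩ Cᶜ) ∪ (Bᶜ ∩ Cᶜ)) := by
    intro x _
    simp only [mem_union, mem_inter, mem_compl]
    tauto
  have h3 := card_le_card hcover
  have h4 := card_union_le ((A ∩ B) ∪ (A ∩ C) ∪ (B ∩ C)) ((Aᶜ ∩ Bᶜ) ∪ (Aᶜ ∩ Cᶜ) ∪ (Bᶜ ∩ Cᶜ))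
  have h5 := card_union_le ((A ∩ B) ∪ (A ∩ C)) (B ∩ C)
  have h6 := card_union_le (A ∩ B) (A ∩ C)
  have h7 := card_union_le ((Aᶜ ∩ Bᶜ) ∪ (Aᶜ ∩ Cᶜ)) (Bᶜ ∩ Cᶜ)
  have h8 := card_union_le (Aᶜ ∩ Bᶜ) (Aᶜ ∩ Cᶜ)
  have := inter h2 hA hB hAB
  have := inter h2 hA hC hAC
  have := inter h2 hB hC hBC
  have := interc hA hB hAB
  have := interc hA hC hAC
  have := interc hB hC hBC
  rw [card_univ] at h3
  omega

/-- Sauer's bound for the avoidance of a configuration with three rows and distinct columns. -/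
theorem card_le_of_not_has_three_rows [Fintype α] {𝒜 : Finset (Finset α)} {l : ℕ}
    {M : Matrix (Fin 3) (Fin l) (Fin 2)} (hM : IsSimple M) (h : ¬ HasMat M 𝒜) :
    #𝒜 ≤ 3 * (Fintype.card α + 1) ^ 2 := by
  have hvc : 𝒜.vcDim ≤ 2 := by
    by_contra! hcon
    obtain ⟨s, hs, hs3⟩ : ∃ s, 𝒜.Shatters s ∧ 2 < #s := by
      by_contra! hall
      exact absurd (Finset.sup_le fun s hs => hall s (mem_shatterer.1 hs)) (not_le.2 hcon)
    obtain ⟨t, hts, ht3⟩ := exists_subset_card_eq (show 3 ≤ #s from hs3)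
    have ht := hs.mono_right hts
    -- A shattered triple carries all eight columns, in particular those of `M`.
    let e : Fin 3 ≃ t := (Fintype.equivFinOfCardEq (by simpa using ht3)).symm
    have h1 : ∀ c, ∃ u ∈ 𝒜, t ∩ u = ({i | M i c = 1} : Finset (Fin 3)).image fun i => (e i : α) :=
      fun c => ht (image_subset_iff.2 fun i _ => (e i).2)
    choose g hg hgt using h1
    refine h (HasMat.of_isSimple hM (fun i => (e i : α))
      (Subtype.val_injective.comp e.injective) g hg fun i c => ?_)
    have h2 : (e i : α) ∈ g c ↔ (e i : α) ∈ t ∩ g c := by simp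
    rw [h2, hgt, mem_image]
    constructor
    · rintro ⟨j, hj, hji⟩
      rw [← e.injective (Subtype.ext hji)]
      exact (mem_filter.1 hj).2
    · exact fun hi => ⟨i, mem_filter.2 ⟨mem_univ _, hi⟩, rfl⟩
  have h1 := card_le_card_shatterer 𝒜 |>.trans card_shatterer_le_sum_vcDim
  refine h1.trans ((sum_le_card_nsmul _ _ ((Fintype.card α + 1) ^ 2) fun k hk => ?_).trans ?_)
  · rw [mem_Iic] at hk
    calc (Fintype.card α).choose k ≤ (Fintype.card α) ^ k := Nat.choose_le_pow _ _
      _ ≤ (Fintype.card α + 1) ^ k := Nat.pow_le_pow_left (Nat.le_succ _) _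
      _ ≤ _ := Nat.pow_le_pow_right (Nat.succ_pos _) (hk.trans hvc)
  · rw [Nat.card_Iic, smul_eq_mul]
    exact Nat.mul_le_mul_right _ (by omega)

end UpperBounds

/-! ### From families to `forb` -/

section Families

theorem fin_two_eq_of_iff {a b : Fin 2} (h : a = 1 ↔ b = 1) : a = b := by
  revert a b; decide

theorem forb_le {m N : ℕ} {ℱ : Set Config}
    (h : ∀ 𝒜 : Finset (Finset (Fin m)), (∀ F ∈ ℱ, ¬ Has F 𝒜) → #𝒜 ≤ N) : forb m ℱ ≤ N := by
  refine csSup_le' ?_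
  rintro n ⟨A, hA, hF⟩
  have hinj : Function.Injective fun j : Fin n => ({i | A i j = 1} : Finset (Fin m)) := by
    intro j j' hj
    refine hA j j' fun i => fin_two_eq_of_iff ?_
    have : i ∈ ({i | A i j = 1} : Finset (Fin m)) ↔ i ∈ ({i | A i j' = 1} : Finset (Fin m)) := by
      rw [show ({i | A i j = 1} : Finset (Fin m)) = _ from hj]
    simpa using this
  have h1 := h (univ.image fun j : Fin n => ({i | A i j = 1} : Finset (Fin m))) ?_
  · rwa [card_image_of_injective _ hinj, card_univ, Fintype.card_fin] at h1
  · rintro F hFℱ ⟨f, g, hf, hg, hmem, he⟩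
    simp only [mem_image, mem_univ, true_and] at hmem
    choose j hj using hmem
    refine hF F hFℱ ⟨⟨f, hf⟩, ⟨j, fun c c' hc => hg ?_⟩, ?_⟩
    · rw [← hj c, ← hj c', hc]
    · refine Matrix.ext fun i c => ?_
      refine fin_two_eq_of_iff ?_
      rw [← he i c, ← hj c]
      simp only [conf, mem_filter, mem_univ, true_and]
      rfl

theorem le_forb {m : ℕ} {ℱ : Set Config} (𝒜 : Finset (Finset (Fin m)))
    (h : ∀ F ∈ ℱ, ¬ Has F 𝒜) : #𝒜 ≤ forb m ℱ := by
  refine le_csSup (bddAbove_colCounts m ℱ) ?_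
  refine ⟨Matrix.of fun i j => if i ∈ (𝒜.equivFin.symm j : Finset (Fin m)) then 1 else 0, ?_, ?_⟩
  · intro j j' hj
    refine 𝒜.equivFin.symm.injective (Subtype.ext ?_)
    ext i
    have := hj i
    simp only [Matrix.of_apply] at this
    by_cases h1 : i ∈ (𝒜.equivFin.symm j : Finset (Fin m)) <;>
      by_cases h2 : i ∈ (𝒜.equivFin.symm j' : Finset (Fin m)) <;> simp [h1, h2] at this ⊢
  · rintro F hF ⟨f, g, he⟩
    refine h F hF ⟨f, fun c => (𝒜.equivFin.symm (g c) : Finset (Fin m)), f.injective, ?_, ?_, ?_⟩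
    · exact Subtype.val_injective.comp (𝒜.equivFin.symm.injective.comp g.injective)
    · exact fun c => (𝒜.equivFin.symm (g c)).2
    · intro i c
      rw [← he]
      simp [conf]

end Families

/-! ### Product constructions -/

section Products

/-- A column of the product of two square matrices with rows indexed by the first and the second
block of `m / 2` indices, and with incidence relations `p` and `q`. -/
def prodCol (m : ℕ) (p q : ℕ → ℕ → Prop) [DecidableRel p] [DecidableRel q] (ab : ℕ × ℕ) :
    Finset (Fin m) :=
  {i | (i.1 < m / 2 ∧ p i ab.1) ∨ (m / 2 ≤ i.1 ∧ i.1 < 2 * (m / 2) ∧ q (i - m / 2) ab.2)}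

/-- The family of columns of a product of two square matrices. -/
def prodFamily (m : ℕ) (p q : ℕ → ℕ → Prop) [DecidableRel p] [DecidableRel q] :
    Finset (Finset (Fin m)) :=
  (range (m / 2) ×ˢ range (m / 2)).image (prodCol m p q)

variable {m : ℕ} {p q : ℕ → ℕ → Prop} [DecidableRel p] [DecidableRel q]

theorem card_prodFamily
    (hp : ∀ k, ∀ a < k, ∀ a' < k, (∀ i < k, p i a ↔ p i a') → a = a')
    (hq : ∀ k, ∀ a < k, ∀ a' < k, (∀ i < k, q i a ↔ q i a') → a = a') :
    #(prodFamily m p q) = (m / 2) ^ 2 := by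
  rw [prodFamily, card_image_of_injOn, card_product, card_range, sq]
  rintro ⟨a, b⟩ hab ⟨a', b'⟩ hab' heq
  simp only [coe_product, coe_range, Set.mem_prod, Set.mem_Iio] at hab hab'
  have hmem (i : Fin m) : i ∈ prodCol m p q (a, b) ↔ i ∈ prodCol m p q (a', b') := by
    rw [heq]
  simp only [prodCol, mem_filter, mem_univ, true_and] at hmem
  refine Prod.ext (hp (m / 2) a hab.1 a' hab'.1 fun i hi => ?_)
    (hq (m / 2) b hab.2 b' hab'.2 fun i hi => ?_)
  · have := hmem ⟨i, by omega⟩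
    simpa [hi, not_le.2 hi] using this
  · have := hmem ⟨m / 2 + i, by omega⟩
    have h2 : m / 2 + i < 2 * (m / 2) := by omega
    simpa [h2] using this

/-- An occurrence of `M` in a product family: `s i` tells the block of the row `i`. -/
theorem HasMat.exists_of_prodFamily {k l : ℕ} {M : Matrix (Fin k) (Fin l) (Fin 2)}
    (hM : HitsRows M) (h : HasMat M (prodFamily m p q)) :
    ∃ (s : Fin k → Bool) (x : Fin k → ℕ) (a b : Fin l → ℕ),
      (∀ i c, (if s i then p (x i) (a c) else q (x i) (b c)) ↔ M i c = 1) ∧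
      (∀ i i', i ≠ i' → s i = s i' → x i ≠ x i') ∧ ∀ c c', c ≠ c' → a c = a c' → b c ≠ b c' := by
  obtain ⟨f, g, hf, hg, hmem, he⟩ := h
  simp only [prodFamily, mem_image] at hmem
  choose ab hab hgab using hmem
  -- For odd `m` the last row of the product family is zero, so no row of `M` containing a 1 can lie
  -- there.
  have hlt (i : Fin k) : (f i : ℕ) < 2 * (m / 2) := by
    obtain ⟨c, hc⟩ := hM i
    have := (he i c).2 hc
    rw [← hgab c, prodCol, mem_filter] at this
    omega
  refine ⟨fun i => decide ((f i : ℕ) < m / 2),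
    fun i => if (f i : ℕ) < m / 2 then f i else f i - m / 2, fun c => (ab c).1, fun c => (ab c).2,
    fun i c => ?_, fun i i' hii hs hx => hii (hf (Fin.ext ?_)), fun c c' hcc ha hb => hcc (hg ?_)⟩
  · rw [← he i c, ← hgab c, prodCol, mem_filter]
    by_cases h1 : (f i : ℕ) < m / 2
    · simp [h1, not_le.2 h1]
    · simp [h1, not_lt.1 h1, hlt i]
  · by_cases h1 : (f i : ℕ) < m / 2
    · have h2 : (f i' : ℕ) < m / 2 := by simpa [h1] using hs
      simpa [h1, h2] using hx
    · have h2 : ¬ (f i' : ℕ) < m / 2 := by simpa [h1] using hs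
      simp only [h1, h2, if_false] at hx
      omega
  · rw [← hgab c, ← hgab c', Prod.ext ha hb]

theorem separates_eq : ∀ k : ℕ, ∀ a < k, ∀ a' < k, (∀ i < k, i = a ↔ i = a') → a = a' :=
  fun _ a ha _ _ h => (h a ha).1 rfl

theorem separates_ne : ∀ k : ℕ, ∀ a < k, ∀ a' < k, (∀ i < k, i ≠ a ↔ i ≠ a') → a = a' :=
  fun _ a ha _ _ h => not_not.1 fun h' => (h a ha).2 h' rfl

theorem separates_le : ∀ k : ℕ, ∀ a < k, ∀ a' < k, (∀ i < k, i ≤ a ↔ i ≤ a') → a = a' :=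
  fun _ a ha a' ha' h => le_antisymm ((h a ha).1 le_rfl) ((h a' ha').2 le_rfl)

/-- Each distribution of the rows over the two blocks turns an occurrence into a contradictory
system of comparisons between indices; the other product lemmas work in the same way. -/
theorem not_has_Q2_prodFamily_eq_eq : ¬ Has Q2 (prodFamily m (· = ·) (· = ·)) := by
  intro h
  obtain ⟨s, x, a, b, h, hx, hc⟩ := HasMat.exists_of_prodFamily
    (M := !![1, 1; 1, 1]) (by decide) h
  have hx01 := hx 0 1 (by decide); have hc01 := hc 0 1 (by decide); have h00 := h 0 0
  have h01 := h 0 1; have h10 := h 1 0; have h11 := h 1 1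
  cases t0 : s 0 <;> cases t1 : s 1 <;>
    simp [t0, t1] at hx01 hc01 h00 h01 h10 h11 <;> omega

theorem not_has_Q5_prodFamily_eq_eq : ¬ Has Q5 (prodFamily m (· = ·) (· = ·)) := by
  intro h
  obtain ⟨s, x, a, b, h, hx, hc⟩ := HasMat.exists_of_prodFamily
    (M := !![1; 1; 1]) (by decide) h
  have hx01 := hx 0 1 (by decide); have hx02 := hx 0 2 (by decide)
  have hx12 := hx 1 2 (by decide); have h00 := h 0 0; have h10 := h 1 0; have h20 := h 2 0
  cases t0 : s 0 <;> cases t1 : s 1 <;> cases t2 : s 2 <;>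
    simp [t0, t1, t2] at hx01 hx02 hx12 h00 h10 h20 <;> omega

theorem not_has_Q7_prodFamily_eq_eq : ¬ Has Q7 (prodFamily m (· = ·) (· = ·)) := by
  intro h
  obtain ⟨s, x, a, b, h, hx, hc⟩ := HasMat.exists_of_prodFamily
    (M := !![0, 1, 1; 1, 0, 1; 1, 1, 0]) (by decide) h
  have hx01 := hx 0 1 (by decide); have hx02 := hx 0 2 (by decide)
  have hx12 := hx 1 2 (by decide); have hc01 := hc 0 1 (by decide)
  have hc02 := hc 0 2 (by decide); have hc12 := hc 1 2 (by decide); have h00 := h 0 0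
  have h01 := h 0 1; have h02 := h 0 2; have h10 := h 1 0; have h11 := h 1 1; have h12 := h 1 2
  have h20 := h 2 0; have h21 := h 2 1; have h22 := h 2 2
  cases t0 : s 0 <;> cases t1 : s 1 <;> cases t2 : s 2 <;>
    simp [t0, t1, t2] at hx01 hx02 hx12 hc01 hc02 hc12 h00 h01 h02 h10 h11 h12 h20 h21 h22 <;> omega

theorem not_has_Q6_prodFamily_le_le : ¬ Has Q6 (prodFamily m (· ≤ ·) (· ≤ ·)) := by
  intro h
  obtain ⟨s, x, a, b, h, hx, hc⟩ := HasMat.exists_of_prodFamily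
    (M := !![1, 0, 0; 0, 1, 0; 0, 0, 1]) (by decide) h
  have hx01 := hx 0 1 (by decide); have hx02 := hx 0 2 (by decide)
  have hx12 := hx 1 2 (by decide); have hc01 := hc 0 1 (by decide)
  have hc02 := hc 0 2 (by decide); have hc12 := hc 1 2 (by decide); have h00 := h 0 0
  have h01 := h 0 1; have h02 := h 0 2; have h10 := h 1 0; have h11 := h 1 1; have h12 := h 1 2
  have h20 := h 2 0; have h21 := h 2 1; have h22 := h 2 2
  cases t0 : s 0 <;> cases t1 : s 1 <;> cases t2 : s 2 <;>
    simp [t0, t1, t2] at hx01 hx02 hx12 hc01 hc02 hc12 h00 h01 h02 h10 h11 h12 h20 h21 h22 <;> omega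

theorem not_has_Q7_prodFamily_le_le : ¬ Has Q7 (prodFamily m (· ≤ ·) (· ≤ ·)) := by
  intro h
  obtain ⟨s, x, a, b, h, hx, hc⟩ := HasMat.exists_of_prodFamily
    (M := !![0, 1, 1; 1, 0, 1; 1, 1, 0]) (by decide) h
  have hx01 := hx 0 1 (by decide); have hx02 := hx 0 2 (by decide)
  have hx12 := hx 1 2 (by decide); have hc01 := hc 0 1 (by decide)
  have hc02 := hc 0 2 (by decide); have hc12 := hc 1 2 (by decide); have h00 := h 0 0
  have h01 := h 0 1; have h02 := h 0 2; have h10 := h 1 0; have h11 := h 1 1; have h12 := h 1 2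
  have h20 := h 2 0; have h21 := h 2 1; have h22 := h 2 2
  cases t0 : s 0 <;> cases t1 : s 1 <;> cases t2 : s 2 <;>
    simp [t0, t1, t2] at hx01 hx02 hx12 hc01 hc02 hc12 h00 h01 h02 h10 h11 h12 h20 h21 h22 <;> omega

theorem not_has_Q8_prodFamily_le_le : ¬ Has Q8 (prodFamily m (· ≤ ·) (· ≤ ·)) := by
  intro h
  obtain ⟨s, x, a, b, h, hx, hc⟩ := HasMat.exists_of_prodFamily
    (M := !![1, 0, 1, 0; 0, 1, 0, 1; 0, 0, 1, 1]) (by decide) h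
  have hx01 := hx 0 1 (by decide); have hx02 := hx 0 2 (by decide)
  have hx12 := hx 1 2 (by decide); have h00 := h 0 0; have h01 := h 0 1; have h02 := h 0 2
  have h03 := h 0 3; have h10 := h 1 0; have h11 := h 1 1; have h12 := h 1 2; have h13 := h 1 3
  have h20 := h 2 0; have h21 := h 2 1; have h22 := h 2 2; have h23 := h 2 3
  cases t0 : s 0 <;> cases t1 : s 1 <;> cases t2 : s 2 <;>
    simp [t0, t1, t2] at hx01 hx02 hx12 h00 h01 h02 h03 h10 h11 h12 h13 h20 h21 h22 h23 <;> omega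

theorem not_has_Q7_prodFamily_eq_le : ¬ Has Q7 (prodFamily m (· = ·) (· ≤ ·)) := by
  intro h
  obtain ⟨s, x, a, b, h, hx, hc⟩ := HasMat.exists_of_prodFamily
    (M := !![0, 1, 1; 1, 0, 1; 1, 1, 0]) (by decide) h
  have hx01 := hx 0 1 (by decide); have hx02 := hx 0 2 (by decide)
  have hx12 := hx 1 2 (by decide); have hc01 := hc 0 1 (by decide)
  have hc02 := hc 0 2 (by decide); have hc12 := hc 1 2 (by decide); have h00 := h 0 0
  have h01 := h 0 1; have h02 := h 0 2; have h10 := h 1 0; have h11 := h 1 1; have h12 := h 1 2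
  have h20 := h 2 0; have h21 := h 2 1; have h22 := h 2 2
  cases t0 : s 0 <;> cases t1 : s 1 <;> cases t2 : s 2 <;>
    simp [t0, t1, t2] at hx01 hx02 hx12 hc01 hc02 hc12 h00 h01 h02 h10 h11 h12 h20 h21 h22 <;> omega

theorem not_has_Q9_prodFamily_eq_le : ¬ Has Q9 (prodFamily m (· = ·) (· ≤ ·)) := by
  intro h
  obtain ⟨s, x, a, b, h, hx, hc⟩ := HasMat.exists_of_prodFamily
    (M := !![1, 0; 1, 0; 0, 1; 0, 1]) (by decide) h
  have hx01 := hx 0 1 (by decide); have hx02 := hx 0 2 (by decide)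
  have hx03 := hx 0 3 (by decide); have hx12 := hx 1 2 (by decide)
  have hx13 := hx 1 3 (by decide); have hx23 := hx 2 3 (by decide)
  have hc01 := hc 0 1 (by decide); have h00 := h 0 0; have h01 := h 0 1; have h10 := h 1 0
  have h11 := h 1 1; have h20 := h 2 0; have h21 := h 2 1; have h30 := h 3 0; have h31 := h 3 1
  cases t0 : s 0 <;> cases t1 : s 1 <;> cases t2 : s 2 <;> cases t3 : s 3 <;>
    simp [t0, t1, t2, t3] at hx01 hx02 hx03 hx12 hx13 hx23 hc01 h00 h01 h10 h11 h20 h21 h30 h31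
      <;> omega

theorem not_has_Q3_prodFamily_eq_ne : ¬ Has Q3 (prodFamily m (· = ·) (· ≠ ·)) := by
  intro h
  obtain ⟨s, x, a, b, h, hx, hc⟩ := HasMat.exists_of_prodFamily
    (M := !![0, 0, 0, 1, 1, 1; 0, 1, 1, 0, 0, 1]) (by decide) h
  have hx01 := hx 0 1 (by decide); have hc12 := hc 1 2 (by decide)
  have hc34 := hc 3 4 (by decide); have h00 := h 0 0; have h01 := h 0 1; have h02 := h 0 2
  have h03 := h 0 3; have h04 := h 0 4; have h05 := h 0 5; have h10 := h 1 0; have h11 := h 1 1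
  have h12 := h 1 2; have h13 := h 1 3; have h14 := h 1 4; have h15 := h 1 5
  cases t0 : s 0 <;> cases t1 : s 1 <;>
    simp [t0, t1] at hx01 hc12 hc34 h00 h01 h02 h03 h04 h05 h10 h11 h12 h13 h14 h15 <;> omega

end Products

/-! ### Assembling the quadratic and linear upper bounds -/

section UpperBounds

theorem card_le_quadratic {α : Type*} [Fintype α] [DecidableEq α] {𝒜 : Finset (Finset α)}
    {F : Config} (hF : F ∈ ({Q1, Q2, Q3, Q4, Q5, Q6, Q7, Q8, Q9} : Set Config)) (h : ¬ Has F 𝒜) :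
    #𝒜 ≤ 3 * (Fintype.card α + 1) ^ 2 := by
  rcases hF with rfl | rfl | rfl | rfl | rfl | rfl | rfl | rfl | rfl
  · have := card_le_of_not_has_Q2 (not_has_Q2_compls h)
    rw [card_compls] at this
    nlinarith
  · have := card_le_of_not_has_Q2 h
    nlinarith
  · have := card_le_of_not_has_Q3 h
    nlinarith
  · have := card_le_of_not_has_Q2 (not_has_Q2_compls (not_has_Q1_of_not_has_Q4 h))
    rw [card_compls] at this
    nlinarith
  · have := card_le_of_not_has_Q2 (not_has_Q2_of_not_has_Q5 h)
    nlinarith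
  · exact card_le_of_not_has_three_rows (M := !![1, 0, 0; 0, 1, 0; 0, 0, 1])
      (by unfold IsSimple; decide) h
  · exact card_le_of_not_has_three_rows (M := !![0, 1, 1; 1, 0, 1; 1, 1, 0])
      (by unfold IsSimple; decide) h
  · exact card_le_of_not_has_three_rows (M := !![1, 0, 1, 0; 0, 1, 0, 1; 0, 0, 1, 1])
      (by unfold IsSimple; decide) h
  · have := card_le_of_not_has_Q9 h
    nlinarith

theorem card_le_of_not_has_Q1_Q7 {α : Type*} [Fintype α] [DecidableEq α]
    {𝒜 : Finset (Finset α)} (h1 : ¬ Has Q1 𝒜) (h7 : ¬ Has Q7 𝒜) : #𝒜 ≤ 15 := by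
  have := card_le_of_not_has_Q2_Q6 (not_has_Q2_compls h1) (not_has_Q6_compls h7)
  rwa [card_compls] at this

theorem card_le_linear {α : Type*} [Fintype α] [DecidableEq α] {𝒜 : Finset (Finset α)}
    (hα : 6 < Fintype.card α)
    (h : (¬ Has Q1 𝒜 ∧ ¬ Has Q2 𝒜) ∨ (¬ Has Q1 𝒜 ∧ ¬ Has Q7 𝒜) ∨ (¬ Has Q2 𝒜 ∧ ¬ Has Q6 𝒜) ∨
      ((¬ Has Q1 𝒜 ∨ ¬ Has Q2 𝒜) ∧ (¬ Has Q3 𝒜 ∨ ¬ Has Q8 𝒜 ∨ ¬ Has Q9 𝒜)) ∨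
      (¬ Has Q3 𝒜 ∧ (¬ Has Q6 𝒜 ∨ ¬ Has Q7 𝒜 ∨ ¬ Has Q8 𝒜 ∨ ¬ Has Q9 𝒜)) ∨
      (¬ Has Q9 𝒜 ∧ (¬ Has Q8 𝒜 ∨ ¬ Has Q6 𝒜 ∧ ¬ Has Q7 𝒜))) :
    #𝒜 ≤ 6 * Fintype.card α + 15 := by
  have two {ℬ : Finset (Finset α)} (h2 : ¬ Has Q2 ℬ)
      (h : ¬ Has Q3 ℬ ∨ ¬ Has Q8 ℬ ∨ ¬ Has Q9 ℬ) : #ℬ ≤ 6 * Fintype.card α + 15 := by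
    rcases h with h | h | h
    · have := card_le_of_not_has_Q2_Q3 h2 h
      omega
    · have := card_le_of_not_has_Q2_Q8 h2 h
      omega
    · have := card_le_of_not_has_Q2_Q9 h2 h
      omega
  rcases h with ⟨h1, h2⟩ | ⟨h1, h7⟩ | ⟨h2, h6⟩ | ⟨h12, h⟩ | ⟨h3, h⟩ | h
  · have := card_le_two_of_not_has_Q1_Q2 h1 h2 hα
    omega
  · have := card_le_of_not_has_Q1_Q7 h1 h7
    omega
  · have := card_le_of_not_has_Q2_Q6 h2 h6
    omega
  · rcases h12 with h1 | h2
    · rw [← card_compls]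
      exact two (not_has_Q2_compls h1)
        (h.imp not_has_Q3_compls (.imp not_has_Q8_compls not_has_Q9_compls))
    · exact two h2 h
  · rcases h with h | h | h | h
    · have := card_le_of_not_has_Q3_Q6 h3 h
      omega
    · have := card_le_of_not_has_Q3_Q6 (not_has_Q3_compls h3) (not_has_Q6_compls h)
      rw [card_compls] at this
      omega
    · have := card_le_of_not_has_Q3_Q8 h3 h
      omega
    · have := card_le_of_not_has_Q3_Q9 h3 h
      omega
  · have := ChainLike.card_le h
    omega

variable {ℱ : Set Config}

/-- If no alternative holds, the presence of `Q3`, `Q1` or `Q4`, `Q2` or `Q5`, `Q9`, tested in this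
order, decides which quadratic list contains `ℱ`. -/
theorem mem_of_not_quadraticList (hsub : ℱ ⊆ {Q1, Q2, Q3, Q4, Q5, Q6, Q7, Q8, Q9})
    (hne : ℱ.Nonempty) (h : ¬ QuadraticList ℱ) :
    ((Q1 ∈ ℱ ∨ Q4 ∈ ℱ) ∧ (Q2 ∈ ℱ ∨ Q5 ∈ ℱ)) ∨ ((Q1 ∈ ℱ ∨ Q4 ∈ ℱ) ∧ Q7 ∈ ℱ) ∨
      ((Q2 ∈ ℱ ∨ Q5 ∈ ℱ) ∧ Q6 ∈ ℱ) ∨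
      (((Q1 ∈ ℱ ∨ Q4 ∈ ℱ) ∨ (Q2 ∈ ℱ ∨ Q5 ∈ ℱ)) ∧ (Q3 ∈ ℱ ∨ Q8 ∈ ℱ ∨ Q9 ∈ ℱ)) ∨
      (Q3 ∈ ℱ ∧ (Q6 ∈ ℱ ∨ Q7 ∈ ℱ ∨ Q8 ∈ ℱ ∨ Q9 ∈ ℱ)) ∨
      (Q9 ∈ ℱ ∧ (Q8 ∈ ℱ ∨ Q6 ∈ ℱ ∧ Q7 ∈ ℱ)) := by
  simp only [QuadraticList, not_or] at h
  obtain ⟨g146, g257, g678, g69, g79, g3⟩ := h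
  by_contra hcon
  by_cases q3 : Q3 ∈ ℱ
  · refine g3 (hne.subset_singleton_iff.1 fun F hF => ?_)
    rcases hsub hF with rfl | rfl | rfl | rfl | rfl | rfl | rfl | rfl | rfl <;>
      first | simp; done | (exfalso; grind only)
  by_cases q14 : Q1 ∈ ℱ ∨ Q4 ∈ ℱ
  · refine g146 fun F hF => ?_
    rcases hsub hF with rfl | rfl | rfl | rfl | rfl | rfl | rfl | rfl | rfl <;>
      first | simp; done | (exfalso; grind only)
  by_cases q25 : Q2 ∈ ℱ ∨ Q5 ∈ ℱ
  · refine g257 fun F hF => ?_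
    rcases hsub hF with rfl | rfl | rfl | rfl | rfl | rfl | rfl | rfl | rfl <;>
      first | simp; done | (exfalso; grind only)
  by_cases q9 : Q9 ∈ ℱ
  · by_cases q7 : Q7 ∈ ℱ
    · refine g79 fun F hF => ?_
      rcases hsub hF with rfl | rfl | rfl | rfl | rfl | rfl | rfl | rfl | rfl <;>
        first | simp; done | (exfalso; grind only)
    · refine g69 fun F hF => ?_
      rcases hsub hF with rfl | rfl | rfl | rfl | rfl | rfl | rfl | rfl | rfl <;>
        first | simp; done | (exfalso; grind only)
  · refine g678 fun F hF => ?_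
    rcases hsub hF with rfl | rfl | rfl | rfl | rfl | rfl | rfl | rfl | rfl <;>
      first | simp; done | (exfalso; grind only)

theorem forb_le_quadratic (hsub : ℱ ⊆ {Q1, Q2, Q3, Q4, Q5, Q6, Q7, Q8, Q9}) (hne : ℱ.Nonempty)
    (m : ℕ) : forb m ℱ ≤ 3 * (m + 1) ^ 2 := by
  obtain ⟨F, hF⟩ := hne
  refine forb_le fun 𝒜 h => ?_
  simpa using card_le_quadratic (hsub hF) (h F hF)

theorem forb_le_linear (hsub : ℱ ⊆ {Q1, Q2, Q3, Q4, Q5, Q6, Q7, Q8, Q9}) (hne : ℱ.Nonempty)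
    (hq : ¬ QuadraticList ℱ) {m : ℕ} (hm : 6 < m) : forb m ℱ ≤ 6 * m + 15 := by
  refine forb_le fun 𝒜 h => ?_
  have h14 : Q1 ∈ ℱ ∨ Q4 ∈ ℱ → ¬ Has Q1 𝒜 :=
    fun h' => h'.elim (h _) fun h' => not_has_Q1_of_not_has_Q4 (h _ h')
  have h25 : Q2 ∈ ℱ ∨ Q5 ∈ ℱ → ¬ Has Q2 𝒜 :=
    fun h' => h'.elim (h _) fun h' => not_has_Q2_of_not_has_Q5 (h _ h')
  have h3 := h Q3
  have h6 := h Q6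
  have h7 := h Q7
  have h8 := h Q8
  have h9 := h Q9
  have := card_le_linear (𝒜 := 𝒜) (by simpa using hm) (by
    have := mem_of_not_quadraticList hsub hne hq
    grind only)
  simpa using this

end UpperBounds

/-! ### Lower bounds from products and from I, I^c, T -/

section LowerBounds

variable {ℱ : Set Config}

theorem sq_le_forb {m : ℕ} (hq : QuadraticList ℱ) : (m / 2) ^ 2 ≤ forb m ℱ := by
  rcases hq with h | h | h | h | h | h
  · rw [← card_prodFamily (m := m) separates_eq separates_eq, ← card_compls]
    refine le_forb _ fun F hF => ?_
    rcases h hF with rfl | rfl | rfl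
    · exact not_has_Q1_compls not_has_Q2_prodFamily_eq_eq
    · exact not_has_Q4_compls not_has_Q5_prodFamily_eq_eq
    · exact not_has_Q6_compls not_has_Q7_prodFamily_eq_eq
  · rw [← card_prodFamily (m := m) separates_eq separates_eq]
    refine le_forb _ fun F hF => ?_
    rcases h hF with rfl | rfl | rfl
    · exact not_has_Q2_prodFamily_eq_eq
    · exact not_has_Q5_prodFamily_eq_eq
    · exact not_has_Q7_prodFamily_eq_eq
  · rw [← card_prodFamily (m := m) separates_le separates_le]
    refine le_forb _ fun F hF => ?_
    rcases h hF with rfl | rfl | rfl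
    · exact not_has_Q6_prodFamily_le_le
    · exact not_has_Q7_prodFamily_le_le
    · exact not_has_Q8_prodFamily_le_le
  · rw [← card_prodFamily (m := m) separates_eq separates_le, ← card_compls]
    refine le_forb _ fun F hF => ?_
    rcases h hF with rfl | rfl
    · exact not_has_Q6_compls not_has_Q7_prodFamily_eq_le
    · exact not_has_Q9_compls not_has_Q9_prodFamily_eq_le
  · rw [← card_prodFamily (m := m) separates_eq separates_le]
    refine le_forb _ fun F hF => ?_
    rcases h hF with rfl | rfl
    · exact not_has_Q7_prodFamily_eq_le
    · exact not_has_Q9_prodFamily_eq_le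
  · rw [← card_prodFamily (m := m) separates_eq separates_ne]
    refine le_forb _ fun F hF => ?_
    rw [h] at hF
    obtain rfl := hF
    exact not_has_Q3_prodFamily_eq_ne

theorem isSimple_matI (l : ℕ) : IsSimple (matI l) := fun j j' h => by
  simpa [matI] using h j

theorem isSimple_matIc (l : ℕ) : IsSimple (matIc l) := fun j j' h => by
  simpa [matIc] using h j

theorem isSimple_matT (l : ℕ) : IsSimple (matT l) := fun j j' h => by
  have h1 := h j
  have h2 := h j'
  simp only [matT, Matrix.of_apply, le_refl, if_true] at h1 h2
  refine le_antisymm ?_ ?_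
  · by_contra hcon
    simp [hcon] at h1
  · by_contra hcon
    simp [hcon] at h2

theorem Avoids.le_forb {m n : ℕ} {A : Matrix (Fin m) (Fin n) (Fin 2)} (h : Avoids A ℱ) :
    n ≤ forb m ℱ := le_csSup (bddAbove_colCounts m ℱ) ⟨A, h⟩

theorem le_forb_of_not_meetsBasic (h : ¬ MeetsBasic ℱ) (m : ℕ) : m ≤ forb m ℱ := by
  by_contra hcon
  refine h ⟨m, ?_, ?_, ?_⟩ <;> by_contra! h'
  · exact hcon (Avoids.le_forb ⟨isSimple_matI m, h'⟩)
  · exact hcon (Avoids.le_forb ⟨isSimple_matIc m, h'⟩)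
  · exact hcon (Avoids.le_forb ⟨isSimple_matT m, h'⟩)

end LowerBounds

/-! ### The bounded case: stabilisation and the value of the constant -/

section Bounded

theorem not_in_matI {F : Config} {l : ℕ} (i i' : Fin F.rows) (c : Fin F.cols) (hi : (i : ℕ) ≠ i')
    (h : F.entry i c = 1) (h' : F.entry i' c = 1) : ¬ F.In (conf (matI l)) := by
  rintro ⟨f, g, he⟩
  rw [← he] at h h'
  simp only [conf, matI, Matrix.submatrix_apply, Matrix.of_apply, ite_eq_left_iff,
    zero_ne_one, imp_false, not_not] at h h'
  exact hi (congrArg Fin.val (f.injective (h.trans h'.symm)))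

theorem not_in_matIc {F : Config} {l : ℕ} (i i' : Fin F.rows) (c : Fin F.cols) (hi : (i : ℕ) ≠ i')
    (h : F.entry i c = 0) (h' : F.entry i' c = 0) : ¬ F.In (conf (matIc l)) := by
  rintro ⟨f, g, he⟩
  rw [← he] at h h'
  simp only [conf, matIc, Matrix.submatrix_apply, Matrix.of_apply, ite_eq_left_iff,
    one_ne_zero, imp_false, not_not] at h h'
  exact hi (congrArg Fin.val (f.injective (h.trans h'.symm)))

/-- Columns of T are initial segments, hence nested, while `c` and `c'` are incomparable. -/
theorem not_in_matT {F : Config} {l : ℕ} (i i' : Fin F.rows) (c c' : Fin F.cols)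
    (h10 : F.entry i c = 1) (h00 : F.entry i' c = 0) (h01 : F.entry i c' = 0)
    (h11 : F.entry i' c' = 1) : ¬ F.In (conf (matT l)) := by
  rintro ⟨f, g, he⟩
  rw [← he] at h10 h00 h01 h11
  simp only [conf, matT, Matrix.submatrix_apply, Matrix.of_apply, ite_eq_left_iff,
    ite_eq_right_iff, zero_ne_one, one_ne_zero, imp_false, not_le] at h10 h00 h01 h11
  exact absurd ((not_lt.1 h10).trans_lt (h00.trans_le (not_lt.1 h11))) h01.not_gt

variable {ℱ : Set Config}

theorem MeetsBasic.mem (hsub : ℱ ⊆ {Q1, Q2, Q3, Q4, Q5, Q6, Q7, Q8, Q9}) (h : MeetsBasic ℱ) :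
    (Q1 ∈ ℱ ∨ Q4 ∈ ℱ ∨ Q6 ∈ ℱ) ∧ (Q2 ∈ ℱ ∨ Q5 ∈ ℱ ∨ Q7 ∈ ℱ) ∧
      (Q1 ∈ ℱ ∨ Q2 ∈ ℱ ∨ Q4 ∈ ℱ ∨ Q5 ∈ ℱ) := by
  obtain ⟨l, ⟨F, hF, hI⟩, ⟨F', hF', hI'⟩, ⟨F'', hF'', hT⟩⟩ := h
  refine ⟨?_, ?_, ?_⟩
  · rcases hsub hF with rfl | rfl | rfl | rfl | rfl | rfl | rfl | rfl | rfl
    · exact .inl hF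
    · exact absurd hI (not_in_matI (0 : Fin 2) (1 : Fin 2) (0 : Fin 2) (by decide) rfl rfl)
    · exact absurd hI (not_in_matI (0 : Fin 2) (1 : Fin 2) (5 : Fin 6) (by decide) rfl rfl)
    · exact .inr (.inl hF)
    · exact absurd hI (not_in_matI (0 : Fin 3) (1 : Fin 3) (0 : Fin 1) (by decide) rfl rfl)
    · exact .inr (.inr hF)
    · exact absurd hI (not_in_matI (1 : Fin 3) (2 : Fin 3) (0 : Fin 3) (by decide) rfl rfl)
    · exact absurd hI (not_in_matI (0 : Fin 3) (2 : Fin 3) (2 : Fin 4) (by decide) rfl rfl)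
    · exact absurd hI (not_in_matI (0 : Fin 4) (1 : Fin 4) (0 : Fin 2) (by decide) rfl rfl)
  · rcases hsub hF' with rfl | rfl | rfl | rfl | rfl | rfl | rfl | rfl | rfl
    · exact absurd hI' (not_in_matIc (0 : Fin 2) (1 : Fin 2) (0 : Fin 2) (by decide) rfl rfl)
    · exact .inl hF'
    · exact absurd hI' (not_in_matIc (0 : Fin 2) (1 : Fin 2) (0 : Fin 6) (by decide) rfl rfl)
    · exact absurd hI' (not_in_matIc (0 : Fin 3) (1 : Fin 3) (0 : Fin 1) (by decide) rfl rfl)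
    · exact .inr (.inl hF')
    · exact absurd hI' (not_in_matIc (1 : Fin 3) (2 : Fin 3) (0 : Fin 3) (by decide) rfl rfl)
    · exact .inr (.inr hF')
    · exact absurd hI' (not_in_matIc (1 : Fin 3) (2 : Fin 3) (0 : Fin 4) (by decide) rfl rfl)
    · exact absurd hI' (not_in_matIc (2 : Fin 4) (3 : Fin 4) (0 : Fin 2) (by decide) rfl rfl)
  · rcases hsub hF'' with rfl | rfl | rfl | rfl | rfl | rfl | rfl | rfl | rfl
    · exact .inl hF''
    · exact .inr (.inl hF'')
    · exact absurd hT (not_in_matT (0 : Fin 2) (1 : Fin 2) (3 : Fin 6) (1 : Fin 6) rfl rfl rfl rfl)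
    · exact .inr (.inr (.inl hF''))
    · exact .inr (.inr (.inr hF''))
    · exact absurd hT (not_in_matT (0 : Fin 3) (1 : Fin 3) (0 : Fin 3) (1 : Fin 3) rfl rfl rfl rfl)
    · exact absurd hT (not_in_matT (0 : Fin 3) (1 : Fin 3) (1 : Fin 3) (0 : Fin 3) rfl rfl rfl rfl)
    · exact absurd hT (not_in_matT (0 : Fin 3) (1 : Fin 3) (0 : Fin 4) (1 : Fin 4) rfl rfl rfl rfl)
    · exact absurd hT (not_in_matT (0 : Fin 4) (2 : Fin 4) (0 : Fin 2) (1 : Fin 2) rfl rfl rfl rfl)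

theorem MeetsBasic.forb_le (hsub : ℱ ⊆ {Q1, Q2, Q3, Q4, Q5, Q6, Q7, Q8, Q9}) (h : MeetsBasic ℱ)
    {m : ℕ} (hm : 6 < m) : forb m ℱ ≤ 15 := by
  refine ForbConf.forb_le fun 𝒜 h𝒜 => ?_
  have h14 : Q1 ∈ ℱ ∨ Q4 ∈ ℱ → ¬ Has Q1 𝒜 :=
    fun h' => h'.elim (h𝒜 _) fun h' => not_has_Q1_of_not_has_Q4 (h𝒜 _ h')
  have h25 : Q2 ∈ ℱ ∨ Q5 ∈ ℱ → ¬ Has Q2 𝒜 :=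
    fun h' => h'.elim (h𝒜 _) fun h' => not_has_Q2_of_not_has_Q5 (h𝒜 _ h')
  have hcases : (¬ Has Q1 𝒜 ∧ ¬ Has Q2 𝒜) ∨ (¬ Has Q1 𝒜 ∧ Q7 ∈ ℱ) ∨ (¬ Has Q2 𝒜 ∧ Q6 ∈ ℱ) := by
    have := h.mem hsub
    grind only
  rcases hcases with ⟨h1, h2⟩ | ⟨h1, h7⟩ | ⟨h2, h6⟩
  · exact (card_le_two_of_not_has_Q1_Q2 h1 h2 (by simpa using hm)).trans (by norm_num)
  · exact card_le_of_not_has_Q1_Q7 h1 (h𝒜 _ h7)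
  · exact card_le_of_not_has_Q2_Q6 h2 (h𝒜 _ h6)

theorem exists_avoids_forb (hℱ : ∀ F ∈ ℱ, 0 < F.cols) (m : ℕ) :
    ∃ A : Matrix (Fin m) (Fin (forb m ℱ)) (Fin 2), Avoids A ℱ := by
  refine Nat.sSup_mem (s := colCounts m ℱ) ?_ (bddAbove_colCounts m ℱ)
  exact ⟨0, Matrix.of fun _ j => j.elim0, fun j => j.elim0,
    fun F hF ⟨_, g, _⟩ => (g ⟨0, hℱ F hF⟩).elim0⟩

/-- A row that is repeated at least `k` times can be duplicated without creating a configuration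
with at most `k` rows. -/
theorem Avoids.duplicate_row {m n k : ℕ} {A : Matrix (Fin m) (Fin n) (Fin 2)} (hA : Avoids A ℱ)
    (hℱ : ∀ F ∈ ℱ, F.rows ≤ k) {φ : Fin (m + 1) → Fin m}
    (hφ : ∀ i : Fin m, φ i.castSucc = i)
    {R : Finset (Fin m)}
    (hR : ∀ i ∈ R, ∀ j, A i j = A (φ (Fin.last m)) j) (hr : k ≤ #R) : Avoids (A.submatrix φ id) ℱ := by
  refine ⟨fun j j' h => hA.1 j j' fun i => by simpa [hφ] using h i.castSucc, ?_⟩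
  rintro F hF ⟨f, g, he⟩
  change Fin F.rows ↪ Fin (m + 1) at f
  change Fin F.cols ↪ Fin n at g
  have hval (i : Fin F.rows) (c : Fin F.cols) : A (φ (f i)) (g c) = F.entry i c := by
    rw [← he]; rfl
  have hinj {i i' : Fin F.rows} (hi : f i ≠ Fin.last m) (hi' : f i' ≠ Fin.last m)
      (h : φ (f i) = φ (f i')) : i = i' := by
    obtain ⟨a, ha⟩ := Fin.exists_castSucc_eq.2 hi
    obtain ⟨a', ha'⟩ := Fin.exists_castSucc_eq.2 hi'
    rw [← ha, ← ha'] at h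
    rw [hφ, hφ] at h
    exact f.injective (by rw [← ha, ← ha', h])
  -- An occurrence using the new row uses fewer than `k` other rows, so some copy in `R` is free to
  -- replace it.
  by_cases hlast : ∃ i₀, f i₀ = Fin.last m
  · obtain ⟨i₀, hi₀⟩ := hlast
    have hcard : #((univ.erase i₀).image fun i => φ (f i)) < #R := by
      refine (card_image_le.trans_lt ?_).trans_le ((hℱ F hF).trans hr)
      rw [card_erase_of_mem (mem_univ _), card_univ, Fintype.card_fin]
      have := i₀.2
      omega
    obtain ⟨r', hr', hr'n⟩ := exists_mem_notMem_of_card_lt_card hcard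
    simp only [mem_image, mem_erase, mem_univ, and_true, not_exists, not_and] at hr'n
    refine hA.2 F hF ⟨⟨Function.update (fun i => φ (f i)) i₀ r', ?_⟩, g, ?_⟩
    · intro i i' h
      change Function.update (fun i => φ (f i)) i₀ r' i =
        Function.update (fun i => φ (f i)) i₀ r' i' at h
      by_cases hi : i = i₀ <;> by_cases hi' : i' = i₀
      · rw [hi, hi']
      · subst hi
        rw [Function.update_self, Function.update_of_ne hi'] at h
        exact absurd h.symm (hr'n i' hi')
      · subst hi'
        rw [Function.update_self, Function.update_of_ne hi] at h
        exact absurd h (hr'n i hi)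
      · rw [Function.update_of_ne hi, Function.update_of_ne hi'] at h
        exact hinj (fun h' => hi (f.injective (h'.trans hi₀.symm)))
          (fun h' => hi' (f.injective (h'.trans hi₀.symm))) h
    · refine Matrix.ext fun i c => ?_
      rw [← hval i c]
      change A (Function.update (fun i => φ (f i)) i₀ r' i) (g c) = _
      by_cases hi : i = i₀
      · subst hi
        rw [Function.update_self, hR r' hr', hi₀]
      · rw [Function.update_of_ne hi]
  · push Not at hlast
    exact hA.2 F hF ⟨⟨fun i => φ (f i), fun i i' h => hinj (hlast i) (hlast i') h⟩, g,
      Matrix.ext fun i c => hval i c⟩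

theorem forb_le_forb_succ {m k C : ℕ} (hcols : ∀ F ∈ ℱ, 0 < F.cols) (hrows : ∀ F ∈ ℱ, F.rows ≤ k)
    (hC : forb m ℱ ≤ C) (hm : 2 ^ C * k < m) : forb m ℱ ≤ forb (m + 1) ℱ := by
  obtain ⟨A, hA⟩ := exists_avoids_forb hcols m
  -- With at most `C` columns there are at most `2 ^ C` different rows, so some row occurs more than
  -- `k` times.
  have hcard : Fintype.card (Fin (forb m ℱ) → Fin 2) * k < Fintype.card (Fin m) := by
    simp only [Fintype.card_fun, Fintype.card_fin]
    exact (Nat.mul_le_mul_right k (Nat.pow_le_pow_right two_pos hC)).trans_lt hm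
  obtain ⟨y, hy⟩ := Fintype.exists_lt_card_fiber_of_mul_lt_card (f := fun i j => A i j) hcard
  obtain ⟨r, hr⟩ := card_pos.1 (pos_of_gt hy)
  simp only [mem_filter, mem_univ, true_and] at hr
  subst hr
  refine Avoids.le_forb (hA.duplicate_row hrows
    (φ := fun i => Fin.lastCases (motive := fun _ => Fin m) r id i) (fun i => by simp) (fun i hi j => ?_) hy.le)
  rw [Fin.lastCases_last]
  exact congrFun (mem_filter.1 hi).2 j

theorem exists_eventually_eq_of_le_succ {u : ℕ → ℕ} {C : ℕ} (hC : ∀ᶠ n in atTop, u n ≤ C)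
    (hu : ∀ᶠ n in atTop, u n ≤ u (n + 1)) : ∃ c, ∀ᶠ n in atTop, u n = c := by
  obtain ⟨N, hN⟩ := eventually_atTop.1 (hC.and hu)
  have hmono : Monotone fun n => u (N + n) :=
    monotone_nat_of_le_succ fun n => (hN (N + n) (by omega)).2
  have hbdd : BddAbove (Set.range fun n => u (N + n)) := by
    refine ⟨C, ?_⟩
    rintro _ ⟨n, rfl⟩
    exact (hN (N + n) (by omega)).1
  have h := tendsto_atTop_ciSup hmono hbdd
  rw [nhds_discrete, tendsto_pure] at h
  obtain ⟨M, hM⟩ := eventually_atTop.1 h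
  refine ⟨⨆ n, u (N + n), eventually_atTop.2 ⟨N + M, fun n hn => ?_⟩⟩
  have := hM (n - N) (by omega)
  rwa [Nat.add_sub_cancel' (by omega)] at this

theorem MeetsBasic.exists_eventually_eq (hsub : ℱ ⊆ {Q1, Q2, Q3, Q4, Q5, Q6, Q7, Q8, Q9})
    (h : MeetsBasic ℱ) : ∃ c, ∀ᶠ m in atTop, forb m ℱ = c := by
  have hcols : ∀ F ∈ ℱ, 0 < F.cols := fun F hF => by
    rcases hsub hF with rfl | rfl | rfl | rfl | rfl | rfl | rfl | rfl | rfl <;> decide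
  have hrows : ∀ F ∈ ℱ, F.rows ≤ 4 := fun F hF => by
    rcases hsub hF with rfl | rfl | rfl | rfl | rfl | rfl | rfl | rfl | rfl <;> decide
  have hC : ∀ᶠ m in atTop, forb m ℱ ≤ 15 :=
    (eventually_gt_atTop 6).mono fun m hm => h.forb_le hsub hm
  refine exists_eventually_eq_of_le_succ hC ?_
  filter_upwards [hC, eventually_gt_atTop (2 ^ 15 * 4)] with m hm hm'
  exact forb_le_forb_succ hcols hrows hm hm'

/-- A column with at least five entries has three equal ones. -/
theorem forb_eq_zero {m : ℕ} (hm : 4 < m) (h4 : Q4 ∈ ℱ) (h5 : Q5 ∈ ℱ) : forb m ℱ = 0 := by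
  refine Nat.le_zero.1 (forb_le fun 𝒜 h => ?_)
  rw [Nat.le_zero, card_eq_zero, eq_empty_iff_forall_notMem]
  intro A hA
  have key {B : Finset (Fin m)} (hB : 2 < #B) {M : Matrix (Fin 3) (Fin 1) (Fin 2)}
      (hM : ∀ x ∈ B, ∀ i c, x ∈ A ↔ M i c = 1) : HasMat M 𝒜 := by
    obtain ⟨x, y, z, hx, hy, hz, hxy, hxz, hyz⟩ := two_lt_card_iff.1 hB
    refine ⟨![x, y, z], fun _ => A, injective_vec3 hxy hxz hyz,
      Function.injective_of_subsingleton _, fun _ => hA, fun i c => hM _ ?_ i c⟩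
    fin_cases i <;> assumption
  rcases lt_or_ge 2 #A with h' | h'
  · refine h Q5 h5 (key h' (M := !![1; 1; 1]) fun x hx i c => ?_)
    fin_cases i <;> fin_cases c <;> simpa
  · have hcard : 2 < #Aᶜ := by
      rw [card_compl, Fintype.card_fin]
      omega
    refine h Q4 h4 (key hcard (M := !![0; 0; 0]) fun x hx i c => ?_)
    rw [mem_compl] at hx
    fin_cases i <;> fin_cases c <;> simpa

/-- Only `Q4` and `Q5` have a single column, so the zero column or the all-ones column serves as a
one-column matrix. -/
theorem one_le_forb (hsub : ℱ ⊆ {Q1, Q2, Q3, Q4, Q5, Q6, Q7, Q8, Q9})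
    (h : ¬ (Q4 ∈ ℱ ∧ Q5 ∈ ℱ)) (m : ℕ) : 1 ≤ forb m ℱ := by
  have key {A : Finset (Fin m)} {F : Config} (hF : 1 < F.cols) : ¬ Has F {A} := by
    rintro ⟨f, g, -, hg, hmem, -⟩
    have : (⟨0, by omega⟩ : Fin F.cols) = ⟨1, hF⟩ :=
      hg ((mem_singleton.1 (hmem _)).trans (mem_singleton.1 (hmem _)).symm)
    simp at this
  rcases not_and_or.1 h with h | h
  · refine (card_singleton (∅ : Finset (Fin m))).ge.trans (le_forb _ fun F hF => ?_)
    rcases hsub hF with rfl | rfl | rfl | rfl | rfl | rfl | rfl | rfl | rfl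
    iterate 3 exact key (by decide)
    · exact absurd hF h
    · rintro ⟨f, g, -, -, hmem, he⟩
      have := (he (0 : Fin 3) (0 : Fin 1)).2 rfl
      exact notMem_empty _ ((Finset.ext_iff.1 (mem_singleton.1 (hmem (0 : Fin 1))) _).1 this)
    iterate 4 exact key (by decide)
  · refine (card_singleton (univ : Finset (Fin m))).ge.trans (le_forb _ fun F hF => ?_)
    rcases hsub hF with rfl | rfl | rfl | rfl | rfl | rfl | rfl | rfl | rfl
    iterate 3 exact key (by decide)
    · rintro ⟨f, g, -, -, hmem, he⟩
      have := (he (0 : Fin 3) (0 : Fin 1)).1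
        ((Finset.ext_iff.1 (mem_singleton.1 (hmem (0 : Fin 1))) _).2 (mem_univ _))
      exact absurd this (by decide)
    · exact absurd hF h
    iterate 4 exact key (by decide)

end Bounded

/-! ### Asymptotic notation and the main theorem -/

section Asymptotics

variable {u : ℕ → ℕ}

theorem isTheta_of_le_of_le {v : ℕ → ℕ} {a b : ℕ} (h1 : ∀ᶠ m in atTop, u m ≤ a * v m)
    (h2 : ∀ᶠ m in atTop, v m ≤ b * u m) :
    (fun m => (u m : ℝ)) =Θ[atTop] fun m => (v m : ℝ) := by
  refine ⟨.of_bound a (h1.mono fun m hm => ?_), .of_bound b (h2.mono fun m hm => ?_)⟩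
  · simpa using (by exact_mod_cast hm : (u m : ℝ) ≤ a * v m)
  · simpa using (by exact_mod_cast hm : (v m : ℝ) ≤ b * u m)

theorem not_isTheta_sq_of_isBigO (h : (fun m => (u m : ℝ)) =O[atTop] fun m : ℕ => (m : ℝ)) :
    ¬ (fun m => (u m : ℝ)) =Θ[atTop] fun m : ℕ => (m : ℝ) ^ 2 := by
  intro h'
  obtain ⟨C, hC⟩ := (h'.2.trans h).bound
  obtain ⟨m, hm, hm'⟩ := (hC.and (eventually_gt_atTop (max 0 ⌈C⌉₊))).exists
  have hm0 : (0 : ℝ) < m := by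
    exact_mod_cast (le_max_left 0 _).trans_lt hm'
  have hmC : C < m := (Nat.le_ceil C).trans_lt (by exact_mod_cast (le_max_right 0 _).trans_lt hm')
  simp only [norm_pow, Real.norm_natCast] at hm
  nlinarith

end Asymptotics

end ForbConf

open ForbConf in
theorem mainTheorem1 (ℱ : Set ForbConf.Config)
    (hsub : ℱ ⊆ {ForbConf.Q1, ForbConf.Q2, ForbConf.Q3, ForbConf.Q4, ForbConf.Q5, ForbConf.Q6,
      ForbConf.Q7, ForbConf.Q8, ForbConf.Q9})
    (hne : ℱ.Nonempty) :
    (((fun m : ℕ => (ForbConf.forb m ℱ : ℝ)) =Θ[atTop] (fun m : ℕ => (m : ℝ) ^ 2)) ↔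
      ForbConf.QuadraticList ℱ) ∧
    (¬ ForbConf.QuadraticList ℱ →
      ((fun m : ℕ => (ForbConf.forb m ℱ : ℝ)) =O[atTop] (fun m : ℕ => (m : ℝ))) ∧
      (¬ ForbConf.MeetsBasic ℱ →
        (fun m : ℕ => (ForbConf.forb m ℱ : ℝ)) =Θ[atTop] (fun m : ℕ => (m : ℝ))) ∧
      (ForbConf.MeetsBasic ℱ →
        (∃ c : ℕ, (c = 0 ↔ ForbConf.Q4 ∈ ℱ ∧ ForbConf.Q5 ∈ ℱ) ∧
          ∀ᶠ m : ℕ in atTop, ForbConf.forb m ℱ = c) ∧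
        (¬ (ForbConf.Q4 ∈ ℱ ∧ ForbConf.Q5 ∈ ℱ) →
          (fun m : ℕ => (ForbConf.forb m ℱ : ℝ)) =Θ[atTop] (fun _ : ℕ => (1 : ℝ))))) := by
  have hlin : ¬ QuadraticList ℱ → ∀ᶠ m in atTop, forb m ℱ ≤ 21 * m := fun hq =>
    (eventually_gt_atTop 6).mono fun m hm => (forb_le_linear hsub hne hq hm).trans (by omega)
  have hO : ¬ QuadraticList ℱ →
      ((fun m : ℕ => (forb m ℱ : ℝ)) =O[atTop] (fun m : ℕ => (m : ℝ))) := fun hq =>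
    .of_bound 21 ((hlin hq).mono fun m hm => by
      simpa using (by exact_mod_cast hm : (forb m ℱ : ℝ) ≤ 21 * m))
  refine ⟨⟨fun h => ?_, fun h => ?_⟩, fun hq => ⟨hO hq, fun hb => ?_, fun hb => ⟨?_, fun h45 => ?_⟩⟩⟩
  · by_contra hq
    exact not_isTheta_sq_of_isBigO (hO hq) h
  -- The constants come from `(m + 1) ^ 2 ≤ 4 * m ^ 2` for `m ≥ 1` and `m ≤ 3 * (m / 2)` for `m ≥
  -- 2`.
  · have := isTheta_of_le_of_le (u := fun m => forb m ℱ) (v := fun m => m ^ 2) (a := 12) (b := 9)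
      ((eventually_ge_atTop 1).mono fun m hm =>
        (forb_le_quadratic hsub hne m).trans (by nlinarith))
      ((eventually_ge_atTop 2).mono fun m hm => by
        have h1 : m ≤ 3 * (m / 2) := by omega
        have h2 := sq_le_forb (m := m) h
        calc m ^ 2 ≤ (3 * (m / 2)) ^ 2 := Nat.pow_le_pow_left h1 2
          _ = 9 * (m / 2) ^ 2 := by ring
          _ ≤ 9 * forb m ℱ := Nat.mul_le_mul_left 9 h2)
    simpa using this
  · exact isTheta_of_le_of_le (v := fun m => m) (hlin hq)
      (b := 1) (.of_forall fun m => by simpa using le_forb_of_not_meetsBasic hb m)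
  · obtain ⟨c, hc⟩ := hb.exists_eventually_eq hsub
    refine ⟨c, ⟨fun h0 => ?_, fun h => ?_⟩, hc⟩
    · by_contra h45
      obtain ⟨m, hm⟩ := hc.exists
      have := one_le_forb hsub h45 m
      omega
    · obtain ⟨m, hm, hm'⟩ := (hc.and (eventually_gt_atTop 4)).exists
      rw [← hm, forb_eq_zero hm' h.1 h.2]
  · have := isTheta_of_le_of_le (u := fun m => forb m ℱ) (v := fun _ => 1) (a := 15) (b := 1)
      ((eventually_gt_atTop 6).mono fun m hm => by simpa using hb.forb_le hsub hm)
      (.of_forall fun m => by simpa using one_le_forb hsub h45 m)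
    simpa using this
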